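/- For $\tau$ in the upper half-plane $\mathfrak H$ let $E_4(\tau)=1+240\sum_{k\ge 1}\sigma_3(k)e^{2\pi i k\tau}$ and let $\{h,\tau\}=\left(\frac{h''}{h'}\right)'-\frac12\left(\frac{h''}{h'}\right)^2$ be the Schwarz derivative. Let $m\in\{2,3,4,5\}$, let $\Gamma(m)\subset \mathrm{SL}_2(\mathbb Z)$ be the principal congruence subgroup of level $m$, and let $n\ge 1$ be an integer. Let $h$ be a modular function for $\Gamma(m)$ (a meromorphic $\Gamma(m)$-invariant function on $\mathfrak H$ that is meromorphic at all cusps) which satisfies $$\{h,\tau\}=2\pi^2\left(\frac nm\right)^2E_4(\tau)$$ and has no pole at the cusp $\infty$. Then $h$ has only finitely many poles modulo $\Gamma(m)$. Let $a$ be the number of $\Gamma(m)$-inequivalent poles of $h$ in $\mathfrak H$, and let $b$ be the number of $\Gamma(m)$-inequivalent cusps, other than $\infty$, at which $h$ has a pole (both counted without multiplicity). Then: - if $m=2$, then $(a,b)\in\left\{\left(\frac{3n-1}{2},0\right),\left(\frac{n-1}{2},1\right)\right\}$; - if $m=3$, then $(a,b)\in\{(2n-1,0),(n-1,1)\}$;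 - if $m=4$, then $(a,b)\in\{(3n-2,0),(2n-2,1),(n-2,2)\}$; - if $m=5$, then $(a,b)=(n(6-k)-5,k)$ for some integer $0\le k\le 5$. -/

import Mathlib

open UpperHalfPlane MatrixGroups

namespace ModularSchwarz

/-- The Schwarz derivative `{f, z} = (f''/f')' - (1/2) (f''/f')^2`. -/
noncomputable def schwarzDeriv (f : ℂ → ℂ) (z : ℂ) : ℂ :=
  deriv (fun w ↦ deriv (deriv f) w / deriv f w) z - 1 / 2 * (deriv (deriv f) z / deriv f z) ^ 2

/-- The expansion of a function `h` on the upper half-plane at the cusp `γ ∞`, for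
`γ ∈ SL(2, ℤ)`: the function `F` of the local parameter `q = exp (2 π i τ / m)` near `q = 0`
with `h (γ τ) = F q`. (It is meaningful when `τ ↦ h (γ τ)` is `m`-periodic, which holds if
`h` is invariant under the principal congruence subgroup `Γ(m)`. Its value at `q = 0` is
irrelevant below: only `MeromorphicAt` and `meromorphicOrderAt` are used.) -/
noncomputable def cuspExpansion (m : ℕ) (h : ℍ → ℂ) (γ : SL(2, ℤ)) : ℂ → ℂ :=
  UpperHalfPlane.cuspFunction m (fun τ ↦ h (γ • τ))

/-- A modular function for the principal congruence subgroup `Γ(m)`: a meromorphic function on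
the upper half-plane which is invariant under `Γ(m)` and meromorphic at all the cusps.

A meromorphic function is represented by its unique normal form: it is analytic away from its
poles and takes the conventional value `0` at its poles. -/
structure IsModularFunction (m : ℕ) (h : ℍ → ℂ) : Prop where
  meromorphic : MeromorphicNFOn (h ∘ ofComplex) {z : ℂ | 0 < z.im}
  invariant : ∀ γ ∈ CongruenceSubgroup.Gamma m, ∀ τ : ℍ, h (γ • τ) = h τ
  meromorphic_cusps : ∀ γ : SL(2, ℤ), MeromorphicAt (cuspExpansion m h γ) 0

/-- `h` solves `{h, τ} = 2 π² (n/m)² E₄(τ)`, as an identity of meromorphic functions on the upper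
half-plane, that is, at all points outside a discrete closed subset of it. -/
def IsSchwarzSolution (m n : ℕ) (h : ℍ → ℂ) : Prop :=
  schwarzDeriv (h ∘ ofComplex) =ᶠ[Filter.codiscreteWithin {z : ℂ | 0 < z.im}]
    fun z ↦ 2 * (Real.pi : ℂ) ^ 2 * ((n : ℂ) / (m : ℂ)) ^ 2 * ModularForm.E₄ (ofComplex z)

/-- `h` has a pole at the point `τ` of the upper half-plane. -/
def HasPoleAt (h : ℍ → ℂ) (τ : ℍ) : Prop :=
  meromorphicOrderAt (h ∘ ofComplex) (τ : ℂ) < 0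

/-- `h` has a pole at the cusp `c`. -/
def HasPoleAtCusp (m : ℕ) (h : ℍ → ℂ) (c : OnePoint ℝ) : Prop :=
  ∃ γ : SL(2, ℤ), Matrix.SpecialLinearGroup.mapGL ℝ γ • (OnePoint.infty : OnePoint ℝ) = c ∧
    meromorphicOrderAt (cuspExpansion m h γ) 0 < 0

/-- The set of poles of `h` in `Γ(m) \ ℍ`. -/
def interiorPoles (m : ℕ) (h : ℍ → ℂ) :
    Set (MulAction.orbitRel.Quotient (CongruenceSubgroup.Gamma m) ℍ) :=
  {p | ∃ τ : ℍ, HasPoleAt h τ ∧ p = Quotient.mk _ τ}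

/-- The set of inequivalent cusps of `Γ(m)`, other than the class of `∞`, at which `h` has
a pole. -/
def cuspPoles (m : ℕ) (h : ℍ → ℂ) :
    Set (CuspOrbits (CongruenceSubgroup.Gamma m : Subgroup (GL (Fin 2) ℝ))) :=
  {p | ∃ c : cuspsSubMulAction (CongruenceSubgroup.Gamma m : Subgroup (GL (Fin 2) ℝ)),
    p = Quotient.mk _ c ∧ HasPoleAtCusp m h c ∧
    ∀ g ∈ (CongruenceSubgroup.Gamma m : Subgroup (GL (Fin 2) ℝ)),
      g • (OnePoint.infty : OnePoint ℝ) ≠ c}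

end ModularSchwarz

/-!
Let `Δ` be the modular discriminant. The function `f = h' ^ 6 / Δ` is invariant under `Γ(m)`. The
indicial equation of the Schwarz equation shows that `h'` has order `-2` at the poles of `h` and
order `0` at the other points of `ℍ`; at a cusp, where the Schwarz derivative tends to
`2 π² (n / m)²`, it shows that `h'` behaves like `q ^ (-n)` or `q ^ n`, where
`q = exp (2 π i τ / m)`, according to whether `h` has a pole there or not. As `Δ` behaves like
`q ^ m`, this determines the divisor of `f` on the modular curve `X(m)`. Its degree is `0`, that is,
`12 m (a + n b) = μ (6 n - m)` for the index `μ` of `±Γ(m)` in `SL(2, ℤ)`, and `μ = 6, 12, 24, 60`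
for `m = 2, 3, 4, 5`.

That the degree is `0` is seen on the norm of `f` to level one: divided by suitable powers of the
functions `j - j(p)` it has neither zeros nor poles in `ℍ`, and such a modular function is constant.
-/

namespace ModularSchwarz

open Filter Topology Manifold CongruenceSubgroup

/-! ### The upper half-plane -/

lemma analyticAt_comp_ofComplex {f : ℍ → ℂ} (hf : MDiff f) (τ : ℍ) :
    AnalyticAt ℂ (f ∘ ofComplex) τ :=
  (UpperHalfPlane.mdifferentiable_iff.mp hf).analyticAt
    (isOpen_upperHalfPlaneSet.mem_nhds τ.im_pos)

lemma exists_injOn_of_deriv_ne_zero {f : ℂ → ℂ} {z : ℂ} (hf : AnalyticAt ℂ f z)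
    (h : deriv f z ≠ 0) : ∃ U ∈ 𝓝 z, Set.InjOn f U := by
  have hf' := hf.hasStrictDerivAt.hasStrictFDerivAt_equiv h
  exact ⟨(hf'.toOpenPartialHomeomorph f).source,
    (hf'.toOpenPartialHomeomorph f).open_source.mem_nhds
      hf'.mem_toOpenPartialHomeomorph_source,
    (hf'.toOpenPartialHomeomorph f).injOn⟩

lemma continuous_SL_smul (γ : SL(2, ℤ)) : Continuous (fun τ : ℍ ↦ γ • τ) :=
  continuous_const_smul (Matrix.SpecialLinearGroup.mapGL ℝ γ)

lemma finite_setOf_smul_mem {K L : Set ℍ} (hK : IsCompact K) (hL : IsCompact L) :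
    {γ : SL(2, ℤ) | ∃ z ∈ K, γ • z ∈ L}.Finite := by
  have hfin := ProperlyDiscontinuousSMul.finite_disjoint_inter_image (Γ := 𝒮ℒ) hK hL
  refine Set.Finite.of_finite_image (f := fun γ ↦
    (⟨Matrix.SpecialLinearGroup.mapGL ℝ γ, ⟨γ, rfl⟩⟩ : 𝒮ℒ)) (hfin.subset ?_) ?_
  · rintro _ ⟨γ, ⟨z, hz, hγ⟩, rfl⟩
    exact ⟨γ • z, ⟨z, hz, rfl⟩, hγ⟩
  · exact fun _ _ _ _ h ↦ Matrix.SpecialLinearGroup.mapGL_injective (congrArg Subtype.val h)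

lemma eventually_forall_smul_eq (p p' : ℍ) :
    ∀ᶠ zw : ℍ × ℍ in 𝓝 p ×ˢ 𝓝 p', ∀ γ : SL(2, ℤ), γ • zw.1 = zw.2 → γ • p = p' := by
  obtain ⟨K, hK, hKp⟩ := exists_compact_mem_nhds p
  obtain ⟨L, hL, hLp⟩ := exists_compact_mem_nhds p'
  have hmoves : ∀ᶠ zw : ℍ × ℍ in 𝓝 p ×ˢ 𝓝 p', ∀ γ ∈ {γ : SL(2, ℤ) | ∃ z ∈ K, γ • z ∈ L},
      γ • zw.1 = zw.2 → γ • p = p' := by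
    refine (Filter.eventually_all_finite (finite_setOf_smul_mem hK hL)).mpr fun γ _ ↦ ?_
    by_cases hγ : γ • p = p'
    · exact .of_forall fun _ _ ↦ hγ
    have hlim : Tendsto (fun zw : ℍ × ℍ ↦ (γ • zw.1, zw.2)) (𝓝 p ×ˢ 𝓝 p') (𝓝 (γ • p, p')) := by
      rw [nhds_prod_eq]
      exact (((continuous_SL_smul γ).tendsto p).comp tendsto_fst).prodMk tendsto_snd
    filter_upwards [hlim.eventually ((isOpen_ne_fun continuous_fst continuous_snd).mem_nhds hγ)]
      with zw hne heq
    exact absurd heq hne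
  filter_upwards [hmoves, prod_mem_prod hKp hLp] with zw hzw hmem γ hγ
  exact hzw γ ⟨zw.1, hmem.1, hγ ▸ hmem.2⟩ hγ

lemma exists_T_zpow_smul_eq_of_qParam_eq {τ τ' : ℍ}
    (h : Function.Periodic.qParam 1 τ = Function.Periodic.qParam 1 τ') :
    ∃ k : ℤ, ModularGroup.T ^ k • τ = τ' := by
  obtain ⟨a, ha⟩ := Function.Periodic.qParam_left_inv_mod_period one_ne_zero (τ : ℂ)
  obtain ⟨b, hb⟩ := Function.Periodic.qParam_left_inv_mod_period one_ne_zero (τ' : ℂ)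
  refine ⟨a - b, UpperHalfPlane.ext ?_⟩
  rw [ModularGroup.coe_T_zpow_smul_eq]
  rw [h, hb] at ha
  push_cast at ha ⊢
  linear_combination -ha

/-! ### The modular invariant -/

/-- The modular invariant, in the normalization `E₄ ^ 3 / Δ` with leading term `q⁻¹`. -/
noncomputable def jInv (τ : ℍ) : ℂ := ModularForm.E₄ τ ^ 3 / ModularForm.discriminant τ

lemma E₄_smul (γ : SL(2, ℤ)) (τ : ℍ) :
    ModularForm.E₄ (γ • τ) = denom γ τ ^ 4 * ModularForm.E₄ τ :=
  SlashInvariantForm.slash_action_eqn'' ModularForm.E₄ (MonoidHom.mem_range.mpr ⟨γ, rfl⟩) τ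

lemma discriminant_smul (γ : SL(2, ℤ)) (τ : ℍ) :
    ModularForm.discriminant (γ • τ) = denom γ τ ^ 12 * ModularForm.discriminant τ :=
  SlashInvariantForm.slash_action_eqn'' CuspForm.discriminant
    (MonoidHom.mem_range.mpr ⟨γ, rfl⟩) τ

lemma jInv_smul (γ : SL(2, ℤ)) (τ : ℍ) : jInv (γ • τ) = jInv τ := by
  have hdenom := denom_ne_zero γ τ
  have hΔ := ModularForm.discriminant_ne_zero τ
  rw [jInv, jInv, E₄_smul, discriminant_smul]
  field_simp

lemma analyticAt_E₄ (τ : ℍ) : AnalyticAt ℂ (ModularForm.E₄ ∘ ofComplex) τ :=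
  analyticAt_comp_ofComplex (ModularFormClass.holo ModularForm.E₄) τ

lemma analyticAt_discriminant (τ : ℍ) :
    AnalyticAt ℂ (ModularForm.discriminant ∘ ofComplex) τ :=
  analyticAt_comp_ofComplex (CuspFormClass.holo CuspForm.discriminant) τ

lemma analyticAt_jInv (τ : ℍ) : AnalyticAt ℂ (jInv ∘ ofComplex) τ :=
  ((analyticAt_E₄ τ).pow 3).div (analyticAt_discriminant τ) (ModularForm.discriminant_ne_zero _)

lemma continuous_jInv : Continuous jInv := by
  refine continuous_iff_continuousAt.mpr fun τ ↦ ?_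
  simpa [Function.comp_def] using
    (analyticAt_jInv τ).continuousAt.comp (continuous_coe.continuousAt (x := τ))

lemma analyticAt_cuspFunction_E₄ : AnalyticAt ℂ (cuspFunction 1 ModularForm.E₄) 0 :=
  ModularFormClass.analyticAt_cuspFunction_zero ModularForm.E₄ one_pos one_mem_strictPeriods_SL

lemma cuspFunction_E₄_zero : cuspFunction 1 ModularForm.E₄ 0 = 1 := by
  have hcoeff := EisensteinSeries.E_qExpansion_coeff_zero (k := 4) (by norm_num) ⟨2, rfl⟩
  rw [qExpansion_coeff] at hcoeff
  simpa using hcoeff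

lemma cuspFunction_E₄_qParam (τ : ℍ) :
    cuspFunction 1 ModularForm.E₄ (Function.Periodic.qParam 1 τ) = ModularForm.E₄ τ :=
  SlashInvariantFormClass.eq_cuspFunction ModularForm.E₄ τ one_mem_strictPeriods_SL one_ne_zero

lemma tendsto_E₄_atImInfty : Tendsto (ModularForm.E₄ : ℍ → ℂ) atImInfty (𝓝 1) :=
  ((cuspFunction_E₄_zero ▸ analyticAt_cuspFunction_E₄.continuousAt.tendsto).comp
    (qParam_tendsto_atImInfty one_pos)).congr cuspFunction_E₄_qParam

lemma tendsto_discriminant_div_qParam :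
    Tendsto (fun τ : ℍ ↦ ModularForm.discriminant τ / Function.Periodic.qParam 1 τ)
      atImInfty (𝓝 1) := by
  refine ModularForm.tendsto_atImInfty_tprod_one_sub_eta_q_pow.congr fun τ ↦ ?_
  rw [ModularForm.discriminant_eq_q_prod,
    mul_div_cancel_left₀ _ (Function.Periodic.qParam_ne_zero _)]

lemma tendsto_jInv_mul_qParam :
    Tendsto (fun τ : ℍ ↦ jInv τ * Function.Periodic.qParam 1 τ) atImInfty (𝓝 1) := by
  have hlim := (tendsto_E₄_atImInfty.pow 3).div tendsto_discriminant_div_qParam one_ne_zero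
  simp only [one_pow, div_one] at hlim
  refine hlim.congr fun τ ↦ ?_
  have hΔ := ModularForm.discriminant_ne_zero τ
  simp only [jInv, Pi.div_apply]
  field_simp

/-- The germ of `1 / j` at the cusp `∞`, in the parameter `q`. -/
noncomputable def jInvReciprocal (q : ℂ) : ℂ :=
  cuspFunction 1 ModularForm.discriminant q / cuspFunction 1 ModularForm.E₄ q ^ 3

lemma jInvReciprocal_qParam (τ : ℍ) :
    jInvReciprocal (Function.Periodic.qParam 1 τ) = (jInv τ)⁻¹ := by
  have hΔ : cuspFunction 1 ModularForm.discriminant (Function.Periodic.qParam 1 τ) =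
      ModularForm.discriminant τ :=
    SlashInvariantFormClass.eq_cuspFunction CuspForm.discriminant τ one_mem_strictPeriods_SL
      one_ne_zero
  simp only [jInvReciprocal, hΔ, cuspFunction_E₄_qParam, jInv, inv_div]

lemma exists_injOn_jInvReciprocal : ∃ U ∈ 𝓝 0, Set.InjOn jInvReciprocal U := by
  have hΔan : AnalyticAt ℂ (cuspFunction 1 ModularForm.discriminant) 0 :=
    ModularFormClass.analyticAt_cuspFunction_zero CuspForm.discriminant one_pos
      one_mem_strictPeriods_SL
  have hΔ₀ : cuspFunction 1 ModularForm.discriminant 0 = 0 := by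
    simp [ModularForm.discriminant_cuspFunction_eqOn (Metric.mem_ball_self one_pos)]
  have hΔ₁ : deriv (cuspFunction 1 ModularForm.discriminant) 0 = 1 := by
    have hcoeff := ModularForm.discriminant_qExpansion_coeff_one
    rw [qExpansion_coeff] at hcoeff
    simpa using hcoeff
  have hE : cuspFunction 1 ModularForm.E₄ 0 ^ 3 ≠ 0 := by simp [cuspFunction_E₄_zero]
  have hderiv : deriv jInvReciprocal 0 = 1 := by
    refine (hΔan.differentiableAt.hasDerivAt.div
      (analyticAt_cuspFunction_E₄.differentiableAt.hasDerivAt.pow 3) hE).deriv.trans ?_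
    simp [cuspFunction_E₄_zero, hΔ₀, hΔ₁]
  exact exists_injOn_of_deriv_ne_zero (hΔan.div (analyticAt_cuspFunction_E₄.pow 3) hE)
    (hderiv ▸ one_ne_zero)

lemma exists_forall_smul_eq_of_le_im_of_jInv_eq : ∃ Y : ℝ, ∀ τ τ' : ℍ, Y ≤ τ.im → Y ≤ τ'.im →
    jInv τ = jInv τ' → ∃ γ : SL(2, ℤ), γ • τ = τ' := by
  obtain ⟨U, hU, hinj⟩ := exists_injOn_jInvReciprocal
  obtain ⟨Y, hY⟩ := (atImInfty_mem _).mp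
    ((qParam_tendsto_atImInfty one_pos).eventually_mem hU)
  refine ⟨Y, fun τ τ' hτ hτ' h ↦ ?_⟩
  have hq := hinj (hY τ hτ) (hY τ' hτ') (by simp only [jInvReciprocal_qParam, h])
  obtain ⟨k, hk⟩ := exists_T_zpow_smul_eq_of_qParam_eq hq
  exact ⟨_, hk⟩

lemma not_eventually_jInv_eq (τ : ℍ) :
    ¬ ∀ᶠ z in 𝓝 (τ : ℂ), (jInv ∘ ofComplex) z = (jInv ∘ ofComplex) τ := by
  intro h
  have han : AnalyticOnNhd ℂ (jInv ∘ ofComplex) {z : ℂ | 0 < z.im} :=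
    fun z hz ↦ analyticAt_jInv ⟨z, hz⟩
  have hconst : ∀ τ' : ℍ, jInv τ' = jInv τ := fun τ' ↦ by
    simpa using han.eqOn_of_preconnected_of_eventuallyEq analyticOnNhd_const
      (convex_halfSpace_im_gt 0).isPreconnected τ.im_pos h τ'.im_pos
  have hone := tendsto_jInv_mul_qParam
  simp_rw [hconst] at hone
  have hzero := (qParam_tendsto_atImInfty one_pos).const_mul (jInv τ)
  simp only [mul_zero] at hzero
  exact one_ne_zero (tendsto_nhds_unique hone hzero)

lemma nhds_le_map_jInv (τ : ℍ) : 𝓝 (jInv τ) ≤ map jInv (𝓝 τ) := by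
  have h := (analyticAt_jInv τ).eventually_constant_or_nhds_le_map_nhds.resolve_left
    (not_eventually_jInv_eq τ)
  rw [← isOpenEmbedding_coe.map_nhds_eq] at h
  simpa [Filter.map_map, Function.comp_def] using h

/-! ### Points with the same modular invariant -/

lemma eventually_deriv_jInv_ne_zero (τ : ℍ) :
    ∀ᶠ z in 𝓝[≠] (τ : ℂ), deriv (jInv ∘ ofComplex) z ≠ 0 := by
  refine (analyticAt_jInv τ).deriv.eventually_eq_zero_or_eventually_ne_zero.resolve_left
    fun h ↦ not_eventually_jInv_eq τ ?_
  have hdiff : ∀ᶠ z in 𝓝 (τ : ℂ), DifferentiableAt ℂ (jInv ∘ ofComplex) z :=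
    (analyticAt_jInv τ).eventually_analyticAt.mono fun z hz ↦ hz.differentiableAt
  obtain ⟨r, hr, hball⟩ := Metric.eventually_nhds_iff_ball.mp (h.and hdiff)
  filter_upwards [Metric.ball_mem_nhds (τ : ℂ) hr] with z hz
  exact Metric.isOpen_ball.is_const_of_deriv_eq_zero (convex_ball _ _).isPreconnected
    (fun w hw ↦ (hball w hw).2.differentiableWithinAt) (fun w hw ↦ (hball w hw).1) hz
    (Metric.mem_ball_self hr)

lemma countable_setOf_deriv_jInv_eq_zero :
    {τ : ℍ | deriv (jInv ∘ ofComplex) τ = 0}.Countable := by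
  have hnhds : ∀ τ : ℍ, {z : ℍ | z ≠ τ → deriv (jInv ∘ ofComplex) z ≠ 0} ∈ 𝓝 τ := fun τ ↦ by
    filter_upwards [(continuous_coe.tendsto τ).eventually
      (eventually_nhdsWithin_iff.mp (eventually_deriv_jInv_ne_zero τ))] with z hz hne
    exact hz (fun h ↦ hne (UpperHalfPlane.ext h))
  obtain ⟨t, ht, hcover⟩ := countable_cover_nhds hnhds
  refine ht.mono fun τ hτ ↦ ?_
  obtain ⟨x, hx, hτx⟩ : ∃ x ∈ t, τ ∈ {z : ℍ | z ≠ x → deriv (jInv ∘ ofComplex) z ≠ 0} := by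
    simpa using (Set.ext_iff.mp hcover τ).mpr trivial
  by_contra hne
  exact hτx (fun h ↦ hne (h ▸ hx)) hτ

lemma tendsto_jInv_cobounded : Tendsto jInv atImInfty (Bornology.cobounded ℂ) := by
  have hne : ∀ᶠ τ : ℍ in atImInfty, jInv τ ≠ 0 := by
    filter_upwards [tendsto_jInv_mul_qParam.eventually_ne one_ne_zero] with τ hτ
    exact left_ne_zero_of_mul hτ
  have hlim : Tendsto (fun τ : ℍ ↦ (jInv τ)⁻¹) atImInfty (𝓝 0) := by
    have hdiv := (qParam_tendsto_atImInfty one_pos).div tendsto_jInv_mul_qParam one_ne_zero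
    simp only [zero_div] at hdiv
    refine hdiv.congr' ?_
    filter_upwards [hne] with τ hτ
    have hq := Function.Periodic.qParam_ne_zero (h := 1) (τ : ℂ)
    simp only [Pi.div_apply]
    field_simp
  have hinv := (tendsto_inv₀_nhdsNE_zero (α := ℂ)).comp
    (tendsto_nhdsWithin_iff.mpr ⟨hlim, hne.mono fun _ ↦ inv_ne_zero⟩)
  simpa [Function.comp_def] using hinv

lemma exists_smul_mem_truncatedFundamentalDomain (C : ℝ) : ∃ Y : ℝ, ∀ τ : ℍ, ‖jInv τ‖ ≤ C →
    ∃ γ : SL(2, ℤ), γ • τ ∈ ModularGroup.truncatedFundamentalDomain Y := by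
  obtain ⟨Y, hY⟩ := (atImInfty_mem _).mp
    ((tendsto_norm_atTop_iff_cobounded.mpr tendsto_jInv_cobounded).eventually_gt_atTop C)
  refine ⟨Y, fun τ hτ ↦ ?_⟩
  obtain ⟨γ, hγ⟩ := ModularGroup.exists_smul_mem_fd τ
  refine ⟨γ, hγ, le_of_not_ge fun him ↦ ?_⟩
  have hlt : C < ‖jInv (γ • τ)‖ := hY _ him
  exact hlt.not_ge (by rwa [jInv_smul])

/-- The set of values which `jInv` takes at two inequivalent points. It is shown to be empty
by a clopenness argument away from the countably many critical values of `jInv`. -/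
def multipleValues : Set ℂ :=
  {c | ∃ p p' : ℍ, jInv p = c ∧ jInv p' = c ∧ ∀ γ : SL(2, ℤ), γ • p ≠ p'}

lemma isOpen_multipleValues : IsOpen multipleValues := by
  refine isOpen_iff_mem_nhds.mpr ?_
  rintro c ⟨p, p', hp, hp', hne⟩
  have hev : ∀ᶠ zw : ℍ × ℍ in 𝓝 p ×ˢ 𝓝 p', ∀ γ : SL(2, ℤ), γ • zw.1 ≠ zw.2 := by
    filter_upwards [eventually_forall_smul_eq p p'] with zw h γ hγ
    exact hne γ (h γ hγ)
  obtain ⟨V, hV, V', hV', hVV'⟩ := mem_prod_iff.mp hev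
  filter_upwards [hp ▸ nhds_le_map_jInv p (image_mem_map hV),
    hp' ▸ nhds_le_map_jInv p' (image_mem_map hV')]
  rintro _ ⟨z, hz, rfl⟩ ⟨w, hw, hzw⟩
  exact ⟨z, w, rfl, hzw, hVV' (Set.mk_mem_prod hz hw)⟩

lemma exists_seq_tendsto_of_mem_closure_multipleValues {c : ℂ} (hc : c ∈ closure multipleValues) :
    ∃ (z w : ℍ) (u v : ℕ → ℍ), Tendsto u atTop (𝓝 z) ∧ Tendsto v atTop (𝓝 w) ∧
      jInv z = c ∧ jInv w = c ∧ (∀ k, jInv (u k) = jInv (v k)) ∧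
      ∀ k, ∀ γ : SL(2, ℤ), γ • u k ≠ v k := by
  obtain ⟨x, hx, hlim⟩ := mem_closure_iff_seq_limit.mp hc
  choose p p' hp hp' hne using hx
  obtain ⟨C, hC⟩ := hlim.norm.bddAbove_range
  obtain ⟨Y, hY⟩ := exists_smul_mem_truncatedFundamentalDomain C
  choose g hg using fun k ↦ hY (p k) (by rw [hp]; exact hC ⟨k, rfl⟩)
  choose g' hg' using fun k ↦ hY (p' k) (by rw [hp']; exact hC ⟨k, rfl⟩)
  have hK := ModularGroup.isCompact_truncatedFundamentalDomain Y
  obtain ⟨⟨z, w⟩, -, φ, hφ, hzw⟩ := (hK.prod hK).tendsto_subseq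
    (fun k ↦ Set.mk_mem_prod (hg k) (hg' k))
  have hz : Tendsto (fun k ↦ g (φ k) • p (φ k)) atTop (𝓝 z) :=
    (continuous_fst.tendsto _).comp hzw
  have hw : Tendsto (fun k ↦ g' (φ k) • p' (φ k)) atTop (𝓝 w) :=
    (continuous_snd.tendsto _).comp hzw
  refine ⟨z, w, _, _, hz, hw, ?_, ?_, fun k ↦ by simp only [jInv_smul, hp, hp'],
    fun k γ hγ ↦ hne (φ k) ((g' (φ k))⁻¹ * γ * g (φ k)) ?_⟩
  · refine tendsto_nhds_unique ((continuous_jInv.tendsto z).comp hz) ?_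
    simpa only [Function.comp_def, jInv_smul, hp] using hlim.comp hφ.tendsto_atTop
  · refine tendsto_nhds_unique ((continuous_jInv.tendsto w).comp hw) ?_
    simpa only [Function.comp_def, jInv_smul, hp'] using hlim.comp hφ.tendsto_atTop
  · rw [mul_smul, mul_smul, hγ, inv_smul_smul]

lemma mem_multipleValues_of_mem_closure {c : ℂ} (hc : c ∈ closure multipleValues)
    (hcrit : ∀ τ : ℍ, jInv τ = c → deriv (jInv ∘ ofComplex) τ ≠ 0) : c ∈ multipleValues := by
  obtain ⟨z, w, u, v, hu, hv, hz, hw, hjeq, hne⟩ :=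
    exists_seq_tendsto_of_mem_closure_multipleValues hc
  refine ⟨z, w, hz, hw, fun γ hγ ↦ ?_⟩
  obtain ⟨U, hU, hinj⟩ := exists_injOn_of_deriv_ne_zero (analyticAt_jInv w) (hcrit w hw)
  have hU' := continuous_coe.continuousAt.preimage_mem_nhds hU
  have hγu : Tendsto (fun k ↦ γ • u k) atTop (𝓝 w) :=
    hγ ▸ ((continuous_SL_smul γ).tendsto z).comp hu
  obtain ⟨k, hk, hk'⟩ := ((hγu.eventually_mem hU').and (hv.eventually_mem hU')).exists
  exact hne k γ <| UpperHalfPlane.ext <| hinj hk hk' <| by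
    simp only [Function.comp_apply, ofComplex_apply, jInv_smul, hjeq]

lemma exists_forall_mem_multipleValues_norm_le : ∃ R : ℝ, ∀ c ∈ multipleValues, ‖c‖ ≤ R := by
  obtain ⟨Y, hY⟩ := exists_forall_smul_eq_of_le_im_of_jInv_eq
  obtain ⟨R, hR⟩ := ((ModularGroup.isCompact_truncatedFundamentalDomain Y).image
    continuous_jInv).isBounded.exists_norm_le
  refine ⟨R, ?_⟩
  rintro c ⟨p, p', hp, hp', hne⟩
  by_contra! hlt
  have hhigh : ∀ τ : ℍ, jInv τ = c → ∃ γ : SL(2, ℤ), Y ≤ (γ • τ).im := by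
    intro τ hτ
    obtain ⟨γ, hγ⟩ := ModularGroup.exists_smul_mem_fd τ
    refine ⟨γ, le_of_not_ge fun h ↦ absurd (hR _ ⟨γ • τ, ⟨hγ, h⟩, rfl⟩) ?_⟩
    rw [jInv_smul, hτ]
    exact not_le.mpr hlt
  obtain ⟨γ, hγ⟩ := hhigh p hp
  obtain ⟨γ', hγ'⟩ := hhigh p' hp'
  obtain ⟨g, hg⟩ := hY _ _ hγ hγ' (by rw [jInv_smul, jInv_smul, hp, hp'])
  refine hne (γ'⁻¹ * g * γ) ?_
  rw [mul_smul, mul_smul, hg, inv_smul_smul]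

lemma multipleValues_eq_empty : multipleValues = ∅ := by
  set B : Set ℂ := jInv '' {τ : ℍ | deriv (jInv ∘ ofComplex) τ = 0}
  have hcount : B.Countable := countable_setOf_deriv_jInv_eq_zero.image _
  have hconn : IsPreconnected Bᶜ :=
    (hcount.isConnected_compl_of_one_lt_rank (by simp)).isPreconnected
  have hdense : Dense Bᶜ := hcount.dense_compl ℝ
  by_contra hne
  have hmeets := hdense.inter_open_nonempty _ isOpen_multipleValues
    (Set.nonempty_iff_ne_empty.mpr hne)
  have hsub : Bᶜ ⊆ multipleValues :=
    hconn.subset_of_closure_inter_subset isOpen_multipleValues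
      (by rwa [Set.inter_comm]) fun c ⟨hc, hcB⟩ ↦ mem_multipleValues_of_mem_closure hc
        fun τ hτ h₀ ↦ hcB ⟨τ, h₀, hτ⟩
  obtain ⟨R, hR⟩ := exists_forall_mem_multipleValues_norm_le
  obtain ⟨x, hx⟩ := NormedField.exists_lt_norm ℂ R
  obtain ⟨c, hc, hcB⟩ := hdense.inter_open_nonempty {c : ℂ | R < ‖c‖}
    (isOpen_lt continuous_const continuous_norm) ⟨x, hx⟩
  exact absurd (hR c (hsub hcB)) (not_le.mpr hc)

theorem exists_smul_eq_of_jInv_eq {p p' : ℍ} (h : jInv p = jInv p') :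
    ∃ γ : SL(2, ℤ), γ • p = p' := by
  by_contra! hne
  have hmem : jInv p ∈ multipleValues := ⟨p, p', rfl, h.symm, hne⟩
  simp [multipleValues_eq_empty] at hmem

/-! ### Local multiplicities -/

lemma exists_analyticAt_pow_eq {g : ℂ → ℂ} {p : ℂ} {k : ℕ} (hg : AnalyticAt ℂ g p) (hgp : g p ≠ 0)
    (hk : k ≠ 0) : ∃ r : ℂ → ℂ, AnalyticAt ℂ r p ∧ r p ≠ 0 ∧ ∀ z, r z ^ k = g z := by
  obtain ⟨c, hc⟩ := IsAlgClosed.exists_pow_nat_eq (g p) (Nat.pos_of_ne_zero hk)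
  have hc₀ : c ≠ 0 := fun h ↦ hgp (by rw [← hc, h, zero_pow hk])
  have han : AnalyticAt ℂ (fun z ↦ (g z / g p) ^ ((k : ℂ)⁻¹)) p :=
    hg.div_const.cpow analyticAt_const (by simp [div_self hgp])
  refine ⟨fun z ↦ c * (g z / g p) ^ ((k : ℂ)⁻¹), analyticAt_const.mul han,
    by simpa [div_self hgp] using hc₀, fun z ↦ ?_⟩
  rw [mul_pow, hc, Complex.cpow_nat_inv_pow _ hk, mul_div_cancel₀ _ hgp]

lemma exists_openPartialHomeomorph_pow_eq {f : ℂ → ℂ} {p : ℂ} (hf : AnalyticAt ℂ f p)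
    (hnc : ¬ ∀ᶠ z in 𝓝 p, f z = f p) :
    ∃ k : ℕ, k ≠ 0 ∧ meromorphicOrderAt (fun z ↦ f z - f p) p = (k : ℤ) ∧
      ∃ ψ : OpenPartialHomeomorph ℂ ℂ, p ∈ ψ.source ∧ ψ p = 0 ∧
        ∀ z ∈ ψ.source, f z = f p + ψ z ^ k := by
  have hsub : AnalyticAt ℂ (fun z ↦ f z - f p) p := hf.sub analyticAt_const
  obtain ⟨k, g, hg, hgp, hfg⟩ := hsub.exists_eventuallyEq_pow_smul_nonzero_iff.mpr
    (by simpa only [sub_eq_zero] using hnc)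
  have hk : k ≠ 0 := by
    rintro rfl
    exact hgp (by simpa using hfg.self_of_nhds.symm)
  have hord : meromorphicOrderAt (fun z ↦ f z - f p) p = (k : ℤ) :=
    (meromorphicOrderAt_eq_int_iff hsub.meromorphicAt).mpr
      ⟨g, hg, hgp, by simpa using hfg.filter_mono nhdsWithin_le_nhds⟩
  obtain ⟨r, hr, hrp, hrk⟩ := exists_analyticAt_pow_eq hg hgp hk
  have hderiv : HasStrictDerivAt (fun z ↦ (z - p) * r z) (r p) p := by
    simpa using HasStrictDerivAt.fun_mul ((hasStrictDerivAt_id p).sub_const p)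
      hr.hasStrictDerivAt
  have hψ := hderiv.hasStrictFDerivAt_equiv hrp
  obtain ⟨U, hU, hUo, hpU⟩ := eventually_nhds_iff.mp hfg
  refine ⟨k, hk, hord, (hψ.toOpenPartialHomeomorph _).restrOpen U hUo,
    ⟨hψ.mem_toOpenPartialHomeomorph_source, hpU⟩, by simp, fun z hz ↦ ?_⟩
  have hz' : f z - f p = (z - p) ^ k * g z := hU z hz.2
  change f z = f p + ((z - p) * r z) ^ k
  rw [mul_pow, hrk, ← hz', add_sub_cancel]

lemma ncard_setOf_pow_eq_pow {k : ℕ} (hk : k ≠ 0) {a : ℂ} (ha : a ≠ 0) :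
    {u : ℂ | u ^ k = a ^ k}.ncard = k := by
  have hζ := Complex.isPrimitiveRoot_exp k hk
  have hset : {u : ℂ | u ^ k = a ^ k} = (Polynomial.nthRootsFinset k (a ^ k) : Finset ℂ) := by
    ext u
    simp [Polynomial.mem_nthRootsFinset (Nat.pos_of_ne_zero hk)]
  rw [hset, Set.ncard_coe_finset, Polynomial.nthRootsFinset,
    Multiset.toFinset_card_of_nodup (hζ.nthRoots_nodup (pow_ne_zero k ha)), hζ.card_nthRoots,
    if_pos ⟨a, rfl⟩]

lemma exists_order_eq_forall_ncard_fiber {f : ℂ → ℂ} {p : ℂ} (hf : AnalyticAt ℂ f p)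
    (hnc : ¬ ∀ᶠ z in 𝓝 p, f z = f p) :
    ∃ k : ℕ, meromorphicOrderAt (fun z ↦ f z - f p) p = (k : ℤ) ∧
      ∀ V ∈ 𝓝 p, ∃ W ∈ 𝓝 p, W ⊆ V ∧ ∀ z ∈ W, z ≠ p → {w ∈ W | f w = f z}.ncard = k := by
  obtain ⟨k, hk, hord, ψ, hp, hψp, hfψ⟩ := exists_openPartialHomeomorph_pow_eq hf hnc
  refine ⟨k, hord, fun V hV ↦ ?_⟩
  have htarget : (0 : ℂ) ∈ ψ.target := hψp ▸ ψ.map_source hp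
  have hsymm : Tendsto ψ.symm (𝓝 0) (𝓝 p) := by
    have hcont := (ψ.continuousAt_symm htarget).tendsto
    rwa [← hψp, ψ.left_inv hp, hψp] at hcont
  obtain ⟨r, hr, hball⟩ := Metric.mem_nhds_iff.mp
    (inter_mem (hsymm hV) (ψ.open_target.mem_nhds htarget))
  refine ⟨ψ.source ∩ ψ ⁻¹' Metric.ball 0 r,
    (ψ.isOpen_inter_preimage Metric.isOpen_ball).mem_nhds ⟨hp, by simpa [hψp] using hr⟩,
    fun z ⟨hz, hzr⟩ ↦ ψ.left_inv hz ▸ (hball hzr).1, fun z ⟨hz, hzr⟩ hzp ↦ ?_⟩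
  have hψz : ψ z ≠ 0 := fun h ↦ hzp (ψ.injOn hz hp (h.trans hψp.symm))
  have hroots : {u : ℂ | u ^ k = ψ z ^ k} ⊆ Metric.ball 0 r := fun u hu ↦ by
    have hnorm : ‖u‖ = ‖ψ z‖ := (pow_left_inj₀ (norm_nonneg _) (norm_nonneg _) hk).mp (by
      rw [← norm_pow, ← norm_pow, hu])
    simpa only [Set.mem_preimage, mem_ball_zero_iff, hnorm] using hzr
  have hfiber : {w ∈ ψ.source ∩ ψ ⁻¹' Metric.ball 0 r | f w = f z} =
      ψ.symm '' {u | u ^ k = ψ z ^ k} := by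
    ext w
    constructor
    · rintro ⟨⟨hw, -⟩, hwz⟩
      rw [hfψ w hw, hfψ z hz, add_right_inj] at hwz
      exact ⟨ψ w, hwz, ψ.left_inv hw⟩
    · rintro ⟨u, hu, rfl⟩
      have hut := (hball (hroots hu)).2
      refine ⟨⟨ψ.map_target hut, ?_⟩, ?_⟩
      · rw [Set.mem_preimage, ψ.right_inv hut]
        exact hroots hu
      · rw [hfψ _ (ψ.map_target hut), ψ.right_inv hut, hfψ z hz, hu]
  rw [hfiber, (ψ.symm.injOn.mono fun u hu ↦ (hball (hroots hu)).2).ncard_image,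
    ncard_setOf_pow_eq_pow hk hψz]

/-! ### Stabilizers in the modular group -/

lemma smul_eq_iff_num (γ : SL(2, ℤ)) (z w : ℍ) :
    γ • z = w ↔ (γ 0 0 * z + γ 0 1 : ℂ) = w * (γ 1 0 * z + γ 1 1) := by
  have hdenom := denom_ne_zero γ z
  rw [ModularGroup.denom_apply] at hdenom
  rw [UpperHalfPlane.ext_iff, UpperHalfPlane.coe_specialLinearGroup_apply, div_eq_iff]
  · simp
  · simpa using hdenom

lemma sub_eq_of_smul_eq {γ : SL(2, ℤ)} {z : ℍ} (hz : γ • z = z) :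
    (γ 0 0 : ℝ) - γ 1 1 = 2 * γ 1 0 * z.re := by
  have him := congrArg Complex.im ((smul_eq_iff_num γ z z).mp hz)
  simp only [Complex.add_im, Complex.mul_im, Complex.add_re, Complex.mul_re, Complex.intCast_re,
    Complex.intCast_im, zero_mul, sub_zero, add_zero, coe_im, coe_re] at him
  refine mul_left_cancel₀ z.im_pos.ne' ?_
  linear_combination him

lemma apply_zero_one_of_smul_eq {γ : SL(2, ℤ)} {z : ℍ} (hz : γ • z = z) :
    (γ 0 1 : ℝ) = -γ 1 0 * (z.re ^ 2 + z.im ^ 2) := by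
  have hre := congrArg Complex.re ((smul_eq_iff_num γ z z).mp hz)
  simp only [Complex.add_re, Complex.mul_re, Complex.add_im, Complex.mul_im, Complex.intCast_re,
    Complex.intCast_im, zero_mul, sub_zero, add_zero, coe_im, coe_re] at hre
  linear_combination hre - z.re * sub_eq_of_smul_eq hz

lemma trace_sq_of_smul_eq {γ : SL(2, ℤ)} {z : ℍ} (hz : γ • z = z) :
    ((γ 0 0 : ℝ) + γ 1 1) ^ 2 = 4 - 4 * (γ 1 0 * z.im) ^ 2 := by
  have hdet := Matrix.SpecialLinearGroup.det_coe γ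
  rw [Matrix.det_fin_two] at hdet
  have hdet' : (γ 0 0 : ℝ) * γ 1 1 - γ 0 1 * γ 1 0 = 1 := by exact_mod_cast hdet
  linear_combination (γ 0 0 - γ 1 1 + 2 * γ 1 0 * z.re : ℝ) * sub_eq_of_smul_eq hz +
    4 * (γ 1 0 : ℝ) * apply_zero_one_of_smul_eq hz + 4 * hdet'

lemma eq_one_or_neg_one_of_smul_eq_of_apply_eq_zero {γ : SL(2, ℤ)} {z : ℍ} (hz : γ • z = z)
    (hc : γ 1 0 = 0) : γ = 1 ∨ γ = -1 := by
  have hda : γ 1 1 = γ 0 0 := by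
    have hsub := sub_eq_of_smul_eq hz
    rw [hc, Int.cast_zero, mul_zero, zero_mul, sub_eq_zero] at hsub
    exact_mod_cast hsub.symm
  have hb : γ 0 1 = 0 := by
    have hb' := apply_zero_one_of_smul_eq hz
    rw [hc, Int.cast_zero, neg_zero, zero_mul] at hb'
    exact_mod_cast hb'
  have hdet := Matrix.SpecialLinearGroup.det_coe γ
  rw [Matrix.det_fin_two, hc, hda, mul_zero, sub_zero] at hdet
  refine (Int.mul_eq_one_iff_eq_one_or_neg_one.mp hdet).imp (fun ⟨ha, _⟩ ↦ ?_) fun ⟨ha, _⟩ ↦ ?_ <;>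
  · ext i j
    fin_cases i <;> fin_cases j <;> simp [hc, hb, hda, ha]

lemma eq_one_or_neg_one_of_smul_eq {γ : SL(2, ℤ)} {z p : ℍ} (hzp : z ≠ p) (hz : γ • z = z)
    (hp : γ • p = p) : γ = 1 ∨ γ = -1 := by
  refine eq_one_or_neg_one_of_smul_eq_of_apply_eq_zero hz (not_not.mp fun hc ↦ hzp ?_)
  have hc' : (γ 1 0 : ℝ) ≠ 0 := Int.cast_ne_zero.mpr hc
  have hre : z.re = p.re := mul_left_cancel₀ (mul_ne_zero two_ne_zero hc')
    ((sub_eq_of_smul_eq hz).symm.trans (sub_eq_of_smul_eq hp))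
  have hsq : z.im ^ 2 = p.im ^ 2 := by
    refine mul_left_cancel₀ (pow_ne_zero 2 hc') ?_
    linear_combination (trace_sq_of_smul_eq hz - trace_sq_of_smul_eq hp) / 4
  exact UpperHalfPlane.ext (Complex.ext hre
    ((pow_left_inj₀ z.im_pos.le p.im_pos.le two_ne_zero).mp hsq))

lemma finite_stabilizer (p : ℍ) : Finite (MulAction.stabilizer SL(2, ℤ) p) :=
  (finite_setOf_smul_mem (isCompact_singleton (x := p)) (isCompact_singleton (x := p))).subset
    fun _ hγ ↦ ⟨p, rfl, hγ⟩

lemma neg_one_mem_stabilizer (p : ℍ) : (-1 : SL(2, ℤ)) ∈ MulAction.stabilizer SL(2, ℤ) p := by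
  rw [MulAction.mem_stabilizer_iff, ModularGroup.SL_neg_smul, one_smul]

lemma one_ne_neg_one_SL : (1 : SL(2, ℤ)) ≠ -1 := fun h ↦ by
  have h' := congrArg (fun γ : SL(2, ℤ) ↦ γ 0 0) h
  simp at h'

lemma card_subgroup_eq_two {H : Subgroup SL(2, ℤ)} (hneg : -1 ∈ H)
    (h : ∀ γ ∈ H, γ = 1 ∨ γ = -1) : Nat.card H = 2 := by
  have hset : (H : Set SL(2, ℤ)) = {1, -1} :=
    Set.Subset.antisymm h (Set.pair_subset (one_mem H) hneg)
  rw [← SetLike.coe_sort_coe, Nat.card_coe_set_eq, hset, Set.ncard_pair one_ne_neg_one_SL]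

lemma card_stabilizer_eq_two_mul_ncard_orbit {p z : ℍ} (hzp : z ≠ p) :
    Nat.card (MulAction.stabilizer SL(2, ℤ) p) =
      2 * (MulAction.orbit (MulAction.stabilizer SL(2, ℤ) p) z).ncard := by
  have := finite_stabilizer p
  set S := MulAction.stabilizer SL(2, ℤ) p
  have hcard : Nat.card (MulAction.stabilizer S z) = 2 := by
    rw [Nat.card_congr ((MulAction.stabilizer S z).equivMapOfInjective _
      S.subtype_injective).toEquiv]
    refine card_subgroup_eq_two ⟨⟨-1, neg_one_mem_stabilizer p⟩, neg_one_mem_stabilizer z, rfl⟩ ?_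
    rintro _ ⟨γ, hγz, rfl⟩
    exact eq_one_or_neg_one_of_smul_eq hzp hγz γ.2
  rw [← MulAction.index_stabilizer, ← Subgroup.card_mul_index (MulAction.stabilizer S z), hcard]

/-! ### The orders of `j - j(p)` -/

theorem exists_order_jInv_sub_self (p : ℍ) :
    ∃ k : ℕ, Nat.card (MulAction.stabilizer SL(2, ℤ) p) = 2 * k ∧
      meromorphicOrderAt (fun z ↦ (jInv ∘ ofComplex) z - jInv p) p = (k : ℤ) := by
  obtain ⟨k, hord, hfiber⟩ :=
    exists_order_eq_forall_ncard_fiber (analyticAt_jInv p) (not_eventually_jInv_eq p)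
  refine ⟨k, ?_, by simpa using hord⟩
  have := finite_stabilizer p
  set S := MulAction.stabilizer SL(2, ℤ) p
  obtain ⟨U, hU, U', hU', hUU'⟩ := mem_prod_iff.mp (eventually_forall_smul_eq p p)
  obtain ⟨W, hW, hWU, hcard⟩ := hfiber _ (isOpenEmbedding_coe.image_mem_nhds.mpr (inter_mem hU hU'))
  have horbit : ∀ᶠ z in 𝓝 p, ∀ γ : S, ((γ • z : ℍ) : ℂ) ∈ W := eventually_all.mpr fun γ ↦
    ((continuous_coe.comp (continuous_SL_smul γ)).continuousAt.tendsto.congr' .rfl).eventually_mem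
      (by rwa [Function.comp_apply, show (γ : SL(2, ℤ)) • p = p from γ.2])
  obtain ⟨z, hz, hzp⟩ := ((horbit.filter_mono nhdsWithin_le_nhds).and
    (self_mem_nhdsWithin (a := p) (s := {p}ᶜ))).exists
  have hzW : (z : ℂ) ∈ W := by simpa using hz 1
  rw [card_stabilizer_eq_two_mul_ncard_orbit hzp, ← hcard z hzW fun h ↦ hzp (UpperHalfPlane.ext h),
    ← Set.ncard_image_of_injective _ isOpenEmbedding_coe.injective]
  congr 2
  ext w
  constructor
  · rintro ⟨_, ⟨γ, rfl⟩, rfl⟩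
    refine ⟨hz γ, ?_⟩
    simp only [Function.comp_apply, ofComplex_apply]
    exact jInv_smul γ z
  · rintro ⟨hwW, hwz⟩
    obtain ⟨w, hwU, rfl⟩ := hWU hwW
    obtain ⟨z', hzU, hzz'⟩ := hWU hzW
    obtain rfl := UpperHalfPlane.ext hzz'
    simp only [Function.comp_apply, ofComplex_apply] at hwz
    obtain ⟨γ, hγ⟩ := exists_smul_eq_of_jInv_eq hwz.symm
    exact ⟨w, ⟨⟨γ, hUU' (Set.mk_mem_prod hzU.1 hwU.2) γ hγ⟩, hγ⟩, rfl⟩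

lemma order_jInv_sub_eq_zero {p q : ℍ} (h : ∀ γ : SL(2, ℤ), γ • p ≠ q) :
    meromorphicOrderAt (fun z ↦ (jInv ∘ ofComplex) z - jInv q) p = 0 := by
  have han : AnalyticAt ℂ (fun z ↦ (jInv ∘ ofComplex) z - jInv q) p :=
    (analyticAt_jInv p).sub analyticAt_const
  refine (tendsto_ne_zero_iff_meromorphicOrderAt_eq_zero han.meromorphicAt).mp
    ⟨_, fun h₀ ↦ ?_, han.continuousAt.tendsto.mono_left nhdsWithin_le_nhds⟩
  simp only [Function.comp_apply, ofComplex_apply] at h₀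
  obtain ⟨γ, hγ⟩ := exists_smul_eq_of_jInv_eq (sub_eq_zero.mp h₀)
  exact h γ hγ

/-! ### The group `±Γ(m)` and its cosets -/

lemma ncard_setOf_exists_mul_out_mem {G : Type*} [Group G] (N : Subgroup G) [hN : N.Normal]
    (S : Subgroup G) (g : G) :
    {x : G ⧸ N | ∃ γ ∈ N, g⁻¹ * γ * x.out ∈ S}.ncard =
      Nat.card (S.map (QuotientGroup.mk' N)) := by
  have hset : {x : G ⧸ N | ∃ γ ∈ N, g⁻¹ * γ * x.out ∈ S} =
      (fun y : G ⧸ N ↦ (g : G ⧸ N) * y) '' (S.map (QuotientGroup.mk' N)) := by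
    ext x
    constructor
    · rintro ⟨γ, hγ, hx⟩
      have hγ' : ((γ : G) : G ⧸ N) = 1 := (QuotientGroup.eq_one_iff γ).mpr hγ
      exact ⟨_, ⟨_, hx, rfl⟩, by simp [hγ']⟩
    · rintro ⟨_, ⟨s, hs, rfl⟩, rfl⟩
      set x : G ⧸ N := (g : G ⧸ N) * QuotientGroup.mk' N s with hx
      have hout : (x.out : G ⧸ N) = ((g * s : G) : G ⧸ N) := by
        rw [QuotientGroup.out_eq', hx]
        rfl
      have hmem := hN.conj_mem _ (QuotientGroup.eq.mp hout) x.out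
      refine ⟨g * s * x.out⁻¹, by simpa [mul_assoc] using hmem, ?_⟩
      rwa [show g⁻¹ * (g * s * x.out⁻¹) * x.out = s by group]
  rw [hset, Set.ncard_image_of_injective _ (mul_right_injective _)]
  rfl

lemma card_map_mk'_mul_card_inf {G : Type*} [Group G] (N : Subgroup G) [N.Normal]
    (S : Subgroup G) :
    Nat.card (S.map (QuotientGroup.mk' N)) * Nat.card ↥(N ⊓ S) = Nat.card S := by
  have h := Subgroup.relIndex_mul_relIndex ⊥ (N ⊓ S) S bot_le inf_le_right
  rw [Subgroup.relIndex_bot_left, Subgroup.relIndex_bot_left, Subgroup.inf_relIndex_right] at h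
  rw [← h, mul_comm, ← Subgroup.relIndex_ker, QuotientGroup.ker_mk']

/-- The group `±Γ(m)`. Its cosets, rather than those of `Γ(m)`, are in bijection with the sheets
of `Γ(m) \ ℍ` over `SL(2, ℤ) \ ℍ`. -/
def signedGamma (m : ℕ) : Subgroup SL(2, ℤ) :=
  (Subgroup.zpowers (-1 : SL(2, ZMod m))).comap
    (Matrix.SpecialLinearGroup.map (Int.castRingHom (ZMod m)))

lemma mem_signedGamma {m : ℕ} {γ : SL(2, ℤ)} :
    γ ∈ signedGamma m ↔ γ ∈ Gamma m ∨ -γ ∈ Gamma m := by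
  have hneg : Matrix.SpecialLinearGroup.map (Int.castRingHom (ZMod m)) (-γ) =
      -Matrix.SpecialLinearGroup.map (Int.castRingHom (ZMod m)) γ := by
    ext i j
    simp
  rw [signedGamma, Subgroup.mem_comap, Subgroup.mem_zpowers_iff, Gamma_mem', Gamma_mem', hneg,
    neg_eq_iff_eq_neg]
  constructor
  · rintro ⟨k, hk⟩
    rw [← hk]
    exact (Int.even_or_odd k).imp Even.neg_one_zpow Odd.neg_one_zpow
  · rintro (h | h)
    · exact ⟨0, by rw [h, zpow_zero]⟩
    · exact ⟨1, by rw [h, zpow_one]⟩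

instance instNormalSignedGamma (m : ℕ) : (signedGamma m).Normal := by
  refine ⟨fun γ hγ g ↦ ?_⟩
  rw [mem_signedGamma] at hγ ⊢
  refine hγ.imp (fun h ↦ (Gamma_normal m).conj_mem γ h g) fun h ↦ ?_
  simpa only [mul_neg, neg_mul] using (Gamma_normal m).conj_mem (-γ) h g

instance instFiniteIndexSignedGamma (m : ℕ) [NeZero m] : (signedGamma m).FiniteIndex :=
  have : (Gamma m).FiniteIndex := (Gamma_is_cong_sub m).finiteIndex
  Subgroup.finiteIndex_of_le (H := Gamma m) fun _ hγ ↦ mem_signedGamma.mpr (.inl hγ)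

lemma exists_mem_Gamma_smul_eq {m : ℕ} {γ : SL(2, ℤ)} (hγ : γ ∈ signedGamma m) :
    ∃ γ' ∈ Gamma m, ∀ τ : ℍ, γ' • τ = γ • τ := by
  rcases mem_signedGamma.mp hγ with h | h
  · exact ⟨γ, h, fun _ ↦ rfl⟩
  · exact ⟨-γ, h, fun τ ↦ ModularGroup.SL_neg_smul γ τ⟩

lemma mul_self_dvd_two_sub_trace {m : ℕ} {γ : SL(2, ℤ)} (hγ : γ ∈ Gamma m) :
    (m : ℤ) * m ∣ 2 - (γ 0 0 + γ 1 1) := by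
  have hone : ∀ a : ℤ, (a : ZMod m) = 1 → (m : ℤ) ∣ a - 1 := fun a ha ↦ by
    rw [← ZMod.intCast_zmod_eq_zero_iff_dvd, Int.cast_sub, ha, Int.cast_one, sub_self]
  obtain ⟨h₀₀, h₀₁, h₁₀, h₁₁⟩ := Gamma_mem.mp hγ
  rw [ZMod.intCast_zmod_eq_zero_iff_dvd] at h₀₁ h₁₀
  have hdet := Matrix.SpecialLinearGroup.det_coe γ
  rw [Matrix.det_fin_two] at hdet
  rw [show 2 - (γ 0 0 + γ 1 1) = (γ 0 0 - 1) * (γ 1 1 - 1) - γ 0 1 * γ 1 0 by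
    linear_combination -hdet]
  exact dvd_sub (mul_dvd_mul (hone _ h₀₀) (hone _ h₁₁)) (mul_dvd_mul h₀₁ h₁₀)

lemma eq_one_or_neg_one_of_mem_Gamma {m : ℕ} (hm : 2 ≤ m) {γ : SL(2, ℤ)} (hγ : γ ∈ Gamma m)
    {z : ℍ} (hz : γ • z = z) : γ = 1 ∨ γ = -1 := by
  refine eq_one_or_neg_one_of_smul_eq_of_apply_eq_zero hz (not_not.mp fun hc ↦ ?_)
  have htrace : (γ 0 0 + γ 1 1) ^ 2 < 4 := by
    have hpos : 0 < ((γ 1 0 : ℝ) * z.im) ^ 2 :=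
      sq_pos_of_ne_zero (mul_ne_zero (Int.cast_ne_zero.mpr hc) z.im_pos.ne')
    have htrace' : ((γ 0 0 : ℝ) + γ 1 1) ^ 2 < 4 := by
      rw [trace_sq_of_smul_eq hz]
      linarith
    exact_mod_cast htrace'
  have hm' : (4 : ℤ) ≤ m * m := by
    have : (2 : ℤ) ≤ m := by exact_mod_cast hm
    nlinarith
  have hlt : γ 0 0 + γ 1 1 < 2 := by nlinarith
  have hgt : -2 < γ 0 0 + γ 1 1 := by nlinarith
  have hle := Int.le_of_dvd (by linarith) (mul_self_dvd_two_sub_trace hγ)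
  linarith

lemma card_signedGamma_inf_stabilizer {m : ℕ} (hm : 2 ≤ m) (p : ℍ) :
    Nat.card ↥(signedGamma m ⊓ MulAction.stabilizer SL(2, ℤ) p) = 2 := by
  refine card_subgroup_eq_two ⟨mem_signedGamma.mpr (.inr ?_), neg_one_mem_stabilizer p⟩ ?_
  · rw [neg_neg]
    exact one_mem _
  · rintro γ ⟨hγ, hp⟩
    rcases mem_signedGamma.mp hγ with h | h
    · exact eq_one_or_neg_one_of_mem_Gamma hm h hp
    · have hp' : -γ • p = p := by rwa [ModularGroup.SL_neg_smul]
      exact (eq_one_or_neg_one_of_mem_Gamma hm h hp').symm.imp neg_inj.mp neg_eq_iff_eq_neg.mp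

/-! ### The cusp `∞` and the index of `±Γ(m)` -/

/-- The stabilizer of the cusp `∞` in the modular group. -/
noncomputable def stabilizerInfty : Subgroup SL(2, ℤ) :=
  (MulAction.stabilizer (GL (Fin 2) ℝ) (OnePoint.infty : OnePoint ℝ)).comap
    (Matrix.SpecialLinearGroup.mapGL ℝ)

lemma mem_stabilizerInfty {γ : SL(2, ℤ)} :
    γ ∈ stabilizerInfty ↔ ∃ k : ℤ, γ = ModularGroup.T ^ k ∨ γ = -ModularGroup.T ^ k := by
  have hiff : γ ∈ stabilizerInfty ↔ γ 1 0 = 0 := by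
    rw [stabilizerInfty, Subgroup.mem_comap, MulAction.mem_stabilizer_iff,
      OnePoint.smul_infty_eq_self_iff]
    simp
  rw [hiff]
  constructor
  · intro hc
    obtain ⟨k, hk⟩ := ModularGroup.exists_eq_T_zpow_of_c_eq_zero hc
    have hne : (⟨2 * Complex.I, by simp⟩ : ℍ) ≠ UpperHalfPlane.I := fun h ↦ by
      have him := congrArg UpperHalfPlane.im h
      simp [UpperHalfPlane.im] at him
    have hfix : ∀ z : ℍ, ((ModularGroup.T ^ k)⁻¹ * γ) • z = z := fun z ↦ by
      rw [mul_smul, hk, inv_smul_smul]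
    refine ⟨k, (eq_one_or_neg_one_of_smul_eq hne (hfix _) (hfix _)).imp (fun h ↦ ?_) fun h ↦ ?_⟩
    · rw [← inv_mul_eq_one.mp h]
    · rw [inv_mul_eq_iff_eq_mul.mp h, mul_neg, mul_one]
  · rintro ⟨k, rfl | rfl⟩ <;> simp [ModularGroup.coe_T_zpow]

lemma T_zpow_mem_signedGamma_iff {m : ℕ} {k : ℤ} :
    ModularGroup.T ^ k ∈ signedGamma m ↔ (m : ℤ) ∣ k := by
  rw [mem_signedGamma, Gamma_mem, Gamma_mem, ← ZMod.intCast_zmod_eq_zero_iff_dvd]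
  simp +contextual [ModularGroup.coe_T_zpow]

lemma card_map_mk'_stabilizerInfty (m : ℕ) :
    Nat.card (stabilizerInfty.map (QuotientGroup.mk' (signedGamma m))) = m := by
  have hmap : stabilizerInfty.map (QuotientGroup.mk' (signedGamma m)) =
      Subgroup.zpowers (QuotientGroup.mk' (signedGamma m) ModularGroup.T) := by
    ext x
    simp only [Subgroup.mem_map, Subgroup.mem_zpowers_iff, mem_stabilizerInfty, ← map_zpow]
    constructor
    · rintro ⟨_, ⟨k, rfl | rfl⟩, rfl⟩
      · exact ⟨k, rfl⟩
      · refine ⟨k, (QuotientGroup.eq.mpr (mem_signedGamma.mpr (.inr ?_)))⟩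
        rw [mul_neg, neg_neg, inv_mul_cancel]
        exact one_mem _
    · rintro ⟨k, rfl⟩
      exact ⟨_, ⟨k, .inl rfl⟩, rfl⟩
  rw [hmap, Nat.card_zpowers]
  refine Nat.dvd_right_iff_eq.mp fun k ↦ ?_
  rw [orderOf_dvd_iff_pow_eq_one, ← map_pow, QuotientGroup.mk'_apply, QuotientGroup.eq_one_iff,
    ← zpow_natCast, T_zpow_mem_signedGamma_iff, Int.natCast_dvd_natCast]

lemma exists_isCoprime_intCast_eq {m : ℕ} [NeZero m] {c d : ZMod m} (h : IsCoprime c d) :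
    ∃ c' d' : ℤ, IsCoprime c' d' ∧ (c' : ZMod m) = c ∧ (d' : ZMod m) = d := by
  set a : ℕ := c.val + m with ha
  set b : ℕ := d.val with hb
  set g : ℕ := b.gcd m
  have hm : 0 < m := NeZero.pos m
  have hg₀ : 0 < g := Nat.gcd_pos_of_pos_right b hm
  have hac : (a : ZMod m) = c := by simp [ha]
  have hbd : (b : ZMod m) = d := by simp [hb]
  have hag : IsCoprime (a : ℤ) g := by
    obtain ⟨u, v, huv⟩ := h
    have hdvd : (m : ℤ) ∣ u.val * a + v.val * b - 1 := by
      rw [← ZMod.intCast_zmod_eq_zero_iff_dvd]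
      push_cast
      simp [hac, hbd, huv]
    obtain ⟨w, hw⟩ := hdvd
    obtain ⟨b', hb'⟩ : (g : ℤ) ∣ b := Int.natCast_dvd_natCast.mpr (Nat.gcd_dvd_left b m)
    obtain ⟨m', hm'⟩ : (g : ℤ) ∣ m := Int.natCast_dvd_natCast.mpr (Nat.gcd_dvd_right b m)
    refine ⟨u.val, v.val * b' - m' * w, ?_⟩
    rw [hm', hb'] at hw
    linear_combination hw
  have : NeZero (m / g * a) :=
    ⟨(Nat.mul_pos (Nat.div_pos (Nat.gcd_le_right b hm) hg₀) (by omega)).ne'⟩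
  obtain ⟨x, hx⟩ := ZMod.unitsMap_surjective (Nat.dvd_mul_right (m / g) a)
    (ZMod.unitOfCoprime (b / g) (Nat.coprime_div_gcd_div_gcd hg₀))
  have hxa : Nat.Coprime (x : ZMod (m / g * a)).val a :=
    (ZMod.val_coe_unit_coprime x).coprime_dvd_right (Nat.dvd_mul_left a _)
  refine ⟨a, g * (x : ZMod (m / g * a)).val,
    hag.mul_right (Nat.isCoprime_iff_coprime.mpr hxa.symm), by simpa using hac, ?_⟩
  have hmod : ((x : ZMod (m / g * a)).val : ZMod (m / g)) = (b / g : ℕ) := by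
    have hval := congrArg Units.val hx
    rwa [ZMod.unitsMap_val, ZMod.coe_unitOfCoprime, ← ZMod.natCast_val] at hval
  rw [ZMod.natCast_eq_natCast_iff] at hmod
  have hmul := hmod.mul_left' g
  rw [Nat.mul_div_cancel' (Nat.gcd_dvd_right b m), Nat.mul_div_cancel' (Nat.gcd_dvd_left b m),
    ← ZMod.natCast_eq_natCast_iff, hbd] at hmul
  exact_mod_cast hmul

lemma map_castRingHom_surjective (m : ℕ) [NeZero m] : Function.Surjective
    (Matrix.SpecialLinearGroup.map (n := Fin 2) (Int.castRingHom (ZMod m))) := by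
  intro A
  obtain ⟨c, d, hcop, hc, hd⟩ := exists_isCoprime_intCast_eq (ModularGroup.bottom_row_coprime A)
  obtain ⟨g, -, hg⟩ := ModularGroup.bottom_row_surj (R := ℤ) (show ![c, d] ∈ _ from hcop)
  set B := Matrix.SpecialLinearGroup.map (n := Fin 2) (Int.castRingHom (ZMod m)) g with hB
  have hB₀ : B 1 0 = A 1 0 := by
    rw [← hc, ← show g 1 0 = c from congrFun hg 0]
    rfl
  have hB₁ : B 1 1 = A 1 1 := by
    rw [← hd, ← show g 1 1 = d from congrFun hg 1]
    rfl
  obtain ⟨t, ht⟩ := ZMod.intCast_surjective (A 0 1 * B 0 0 - A 0 0 * B 0 1)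
  have hAdet := Matrix.SpecialLinearGroup.det_coe A
  have hBdet := Matrix.SpecialLinearGroup.det_coe B
  rw [Matrix.det_fin_two] at hAdet hBdet
  rw [hB₀, hB₁] at hBdet
  have hT : ∀ i j, Matrix.SpecialLinearGroup.map (n := Fin 2) (Int.castRingHom (ZMod m))
      (ModularGroup.T ^ t) i j = !![1, (t : ZMod m); 0, 1] i j := by
    intro i j
    rw [SL_reduction_mod_hom_val, ModularGroup.coe_T_zpow]
    fin_cases i <;> fin_cases j <;> simp
  refine ⟨ModularGroup.T ^ t * g, ?_⟩
  rw [map_mul, ← hB]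
  ext i j
  rw [Matrix.SpecialLinearGroup.coe_mul, Matrix.mul_apply, Fin.sum_univ_two, hT, hT]
  fin_cases i <;> fin_cases j <;> simp [hB₀, hB₁, ht]
  · linear_combination (-(B 0 0)) * hAdet + A 0 0 * hBdet
  · linear_combination (-(B 0 1)) * hAdet + A 0 1 * hBdet

lemma orderOf_neg_one_mul_index_signedGamma (m : ℕ) [NeZero m] :
    orderOf (-1 : SL(2, ZMod m)) * (signedGamma m).index = Nat.card SL(2, ZMod m) := by
  rw [signedGamma, Subgroup.index_comap_of_surjective _ (map_castRingHom_surjective m),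
    ← Nat.card_zpowers, Subgroup.card_mul_index]

lemma index_signedGamma_two : (signedGamma 2).index = 6 := by
  have hord : orderOf (-1 : SL(2, ZMod 2)) = 1 := orderOf_eq_one_iff.mpr (by decide)
  rw [← one_mul (Subgroup.index _), ← hord, orderOf_neg_one_mul_index_signedGamma,
    Nat.card_eq_fintype_card]
  decide +kernel

lemma two_mul_index_signedGamma {m : ℕ} [NeZero m] (h : (-1 : SL(2, ZMod m)) ≠ 1) :
    2 * (signedGamma m).index = Fintype.card SL(2, ZMod m) := by
  have hord : orderOf (-1 : SL(2, ZMod m)) = 2 := orderOf_eq_prime (by simp) h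
  have hcard := orderOf_neg_one_mul_index_signedGamma m
  rwa [hord, Nat.card_eq_fintype_card] at hcard

lemma index_signedGamma_three : (signedGamma 3).index = 12 := by
  refine mul_left_cancel₀ two_ne_zero ((two_mul_index_signedGamma (by decide)).trans ?_)
  decide +kernel

lemma index_signedGamma_four : (signedGamma 4).index = 24 := by
  refine mul_left_cancel₀ two_ne_zero ((two_mul_index_signedGamma (by decide)).trans ?_)
  decide +kernel

lemma index_signedGamma_five : (signedGamma 5).index = 60 := by
  refine mul_left_cancel₀ two_ne_zero ((two_mul_index_signedGamma (by decide)).trans ?_)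
  decide +kernel

/-! ### Modular functions of level one without zeros and poles -/

lemma det_SL_coe (γ : SL(2, ℤ)) : (γ : GL (Fin 2) ℝ).val.det = 1 :=
  (Matrix.SpecialLinearGroup.map (Int.castRingHom ℝ) γ).det_coe

lemma det_SL_coe_pos (γ : SL(2, ℤ)) : 0 < (γ : GL (Fin 2) ℝ).val.det :=
  (det_SL_coe γ).symm ▸ one_pos

lemma meromorphicOrderAt_comp_SL_smul (f : ℍ → ℂ) (γ : SL(2, ℤ)) (τ : ℍ) :
    meromorphicOrderAt (fun z ↦ f (γ • ofComplex z)) τ =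
      meromorphicOrderAt (f ∘ ofComplex) ((γ • τ : ℍ) : ℂ) :=
  meromorphicOrderAt_comp_smul (det_SL_coe_pos γ)

lemma comp_SL_smul_comp_ofComplex (f : ℍ → ℂ) (γ : SL(2, ℤ)) :
    (fun σ ↦ f (γ • σ)) ∘ ofComplex = (f ∘ ofComplex) ∘ fun z ↦ ((γ • ofComplex z : ℍ) : ℂ) := by
  ext z
  simp only [Function.comp_apply, ofComplex_apply]

lemma tendsto_coe_nhdsNE (τ : ℍ) : Tendsto ((↑) : ℍ → ℂ) (𝓝[≠] τ) (𝓝[≠] (τ : ℂ)) :=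
  continuous_coe.continuousAt.tendsto.inf (tendsto_principal_principal.mpr fun _ h h' ↦
    h (UpperHalfPlane.ext h'))

lemma tendsto_SL_smul_nhdsNE (γ : SL(2, ℤ)) (τ : ℍ) :
    Tendsto (fun σ : ℍ ↦ γ • σ) (𝓝[≠] τ) (𝓝[≠] (γ • τ)) :=
  (continuous_SL_smul γ).continuousAt.tendsto.inf (tendsto_principal_principal.mpr fun _ h h' ↦
    h (MulAction.injective γ h'))

lemma exists_mdifferentiable_eventuallyEq {Φ : ℍ → ℂ}
    (hmer : ∀ τ : ℍ, MeromorphicAt (Φ ∘ ofComplex) τ)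
    (hord : ∀ τ : ℍ, meromorphicOrderAt (Φ ∘ ofComplex) τ = 0) :
    ∃ Ψ : ℍ → ℂ, MDiff Ψ ∧ (∀ τ, Ψ τ ≠ 0) ∧ ∀ τ, Ψ =ᶠ[𝓝[≠] τ] Φ := by
  have hmer' : MeromorphicOn (Φ ∘ ofComplex) {z : ℂ | 0 < z.im} := fun z hz ↦ hmer ⟨z, hz⟩
  set Ψ : ℂ → ℂ := toMeromorphicNFOn (Φ ∘ ofComplex) {z : ℂ | 0 < z.im} with hΨ
  have hNF (τ : ℍ) : MeromorphicNFAt Ψ τ := meromorphicNFOn_toMeromorphicNFOn _ _ τ.im_pos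
  have hordΨ (τ : ℍ) : meromorphicOrderAt Ψ τ = 0 := by
    rw [hΨ, meromorphicOrderAt_toMeromorphicNFOn hmer' τ.im_pos, hord]
  refine ⟨fun τ ↦ Ψ τ, fun τ ↦ ?_, fun τ ↦ (hNF τ).meromorphicOrderAt_eq_zero_iff.mp (hordΨ τ),
    fun τ ↦ ?_⟩
  · have han : AnalyticAt ℂ Ψ τ :=
      (hNF τ).meromorphicOrderAt_nonneg_iff_analyticAt.mp (hordΨ τ).ge
    exact han.differentiableAt.mdifferentiableAt.comp τ (mdifferentiable_coe τ)
  · filter_upwards [(tendsto_coe_nhdsNE τ).eventually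
      (hmer'.toMeromorphicNFOn_eq_self_on_nhdsNE τ.im_pos)] with σ hσ
    rw [hΨ, hσ, Function.comp_apply, ofComplex_apply]

lemma apply_smul_eq_of_eventuallyEq_nhdsNE {Φ Ψ : ℍ → ℂ} (hΨ : Continuous Ψ)
    (heq : ∀ τ, Ψ =ᶠ[𝓝[≠] τ] Φ) {γ : SL(2, ℤ)} (hinv : ∀ τ, Φ (γ • τ) = Φ τ) (τ : ℍ) :
    Ψ (γ • τ) = Ψ τ := by
  have hne : (fun σ ↦ Ψ (γ • σ)) =ᶠ[𝓝[≠] τ] Ψ := by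
    filter_upwards [heq τ, (tendsto_SL_smul_nhdsNE γ τ).eventually (heq (γ • τ))] with σ hσ hσ'
    rw [hσ', hinv, hσ]
  exact ((ContinuousAt.eventuallyEq_nhds_iff_eventuallyEq_nhdsNE
    (hΨ.comp (continuous_SL_smul γ)).continuousAt hΨ.continuousAt).mp hne).eq_of_nhds

lemma tendsto_atImInfty_of_eventuallyEq_nhdsNE {Φ Ψ : ℍ → ℂ} (hΨ : Continuous Ψ)
    (heq : ∀ τ, Ψ =ᶠ[𝓝[≠] τ] Φ) {c : ℂ} (hΦ : Tendsto Φ atImInfty (𝓝 c)) :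
    Tendsto Ψ atImInfty (𝓝 c) := by
  refine (closed_nhds_basis c).tendsto_right_iff.mpr fun V ⟨hV, hVc⟩ ↦ ?_
  obtain ⟨A, hA⟩ := (atImInfty_mem _).mp (hΦ hV)
  refine (atImInfty_mem _).mpr ⟨A + 1, fun τ hτ ↦ ?_⟩
  refine IsClosed.mem_of_tendsto (s := V) hVc
    (hΨ.continuousAt.tendsto.mono_left nhdsWithin_le_nhds) (b := 𝓝[≠] τ) ?_
  have him : ∀ᶠ σ in 𝓝[≠] τ, A < UpperHalfPlane.im σ :=
    (continuous_im.continuousAt.eventually (lt_mem_nhds (by linarith))).filter_mono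
      nhdsWithin_le_nhds
  filter_upwards [him, heq τ] with σ hσ hσ'
  rw [hσ']
  exact hA σ hσ.le

lemma eq_const_of_smul_eq_of_tendsto {Ψ : ℍ → ℂ} (hΨ : MDiff Ψ)
    (hinv : ∀ (γ : SL(2, ℤ)) (τ : ℍ), Ψ (γ • τ) = Ψ τ) {c : ℂ}
    (hlim : Tendsto Ψ atImInfty (𝓝 c)) : ∃ c', ∀ τ, Ψ τ = c' := by
  have hslash (γ : SL(2, ℤ)) : SlashAction.map (0 : ℤ) γ Ψ = Ψ := by
    ext τ
    rw [ModularForm.SL_slash_apply, neg_zero, zpow_zero, mul_one, hinv]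
  let f : ModularForm 𝒮ℒ 0 :=
    { toFun := Ψ
      slash_action_eq' := by
        rintro _ ⟨γ, rfl⟩
        exact hslash γ
      holo' := hΨ
      bdd_at_cusps' := fun hc ↦ by
        rw [OnePoint.isBoundedAt_iff_forall_SL2Z
          ((Subgroup.IsArithmetic.isCusp_iff_isCusp_SL2Z 𝒮ℒ).mp hc)]
        intro γ _
        rw [hslash]
        exact hlim.isBigO_one ℝ }
  exact (ModularFormClass.levelOne_weight_zero_const f).imp fun c' hc' τ ↦ congrFun hc' τ

lemma not_tendsto_zero_of_order_eq_zero {Φ : ℍ → ℂ}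
    (hinv : ∀ (γ : SL(2, ℤ)) (τ : ℍ), Φ (γ • τ) = Φ τ)
    (hmer : ∀ τ : ℍ, MeromorphicAt (Φ ∘ ofComplex) τ)
    (hord : ∀ τ : ℍ, meromorphicOrderAt (Φ ∘ ofComplex) τ = 0) : ¬ Tendsto Φ atImInfty (𝓝 0) := by
  intro hlim
  obtain ⟨Ψ, hΨ, hne, heq⟩ := exists_mdifferentiable_eventuallyEq hmer hord
  have hlim' := tendsto_atImInfty_of_eventuallyEq_nhdsNE hΨ.continuous heq hlim
  obtain ⟨c, hc⟩ := eq_const_of_smul_eq_of_tendsto hΨ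
    (fun γ ↦ apply_smul_eq_of_eventuallyEq_nhdsNE hΨ.continuous heq (hinv γ)) hlim'
  rw [funext hc, tendsto_const_nhds_iff] at hlim'
  exact hne I ((hc I).trans hlim')

theorem exponent_eq_zero {m : ℕ} (hm : 0 < m) {Φ : ℍ → ℂ} {K : ℤ}
    (hinv : ∀ (γ : SL(2, ℤ)) (τ : ℍ), Φ (γ • τ) = Φ τ)
    (hmer : ∀ τ : ℍ, MeromorphicAt (Φ ∘ ofComplex) τ)
    (hord : ∀ τ : ℍ, meromorphicOrderAt (Φ ∘ ofComplex) τ = 0)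
    (hexp : Φ =Θ[atImInfty] fun τ : ℍ ↦ Function.Periodic.qParam m τ ^ K) : K = 0 := by
  have htendsto (d : ℕ) (hd : d ≠ 0) :
      Tendsto (fun τ : ℍ ↦ Function.Periodic.qParam m τ ^ d) atImInfty (𝓝 0) := by
    simpa [hd] using (qParam_tendsto_atImInfty (Nat.cast_pos.mpr hm)).pow d
  by_contra hK
  rcases lt_or_gt_of_ne hK with hneg | hpos
  · refine not_tendsto_zero_of_order_eq_zero (Φ := Φ⁻¹) (fun γ τ ↦ congrArg (·⁻¹) (hinv γ τ))
      (fun τ ↦ (hmer τ).inv) (fun τ ↦ ?_) (hexp.inv.tendsto_zero_iff.mpr ?_)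
    · exact meromorphicOrderAt_inv.trans (neg_eq_zero.mpr (hord τ))
    · lift -K to ℕ using (by omega) with d hd
      refine (htendsto d (by omega)).congr fun τ ↦ ?_
      rw [← zpow_neg, ← hd, zpow_natCast]
  · refine not_tendsto_zero_of_order_eq_zero hinv hmer hord (hexp.tendsto_zero_iff.mpr ?_)
    lift K to ℕ using hpos.le
    simpa only [zpow_natCast] using htendsto K (by omega)

lemma qParam_one_eq_pow {m : ℕ} (hm : m ≠ 0) (z : ℂ) :
    Function.Periodic.qParam 1 z = Function.Periodic.qParam m z ^ m := by
  have : (m : ℂ) ≠ 0 := Nat.cast_ne_zero.mpr hm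
  simp only [Function.Periodic.qParam, ← Complex.exp_nat_mul]
  push_cast
  field_simp

lemma isTheta_discriminant {m : ℕ} (hm : m ≠ 0) :
    ModularForm.discriminant =Θ[atImInfty] fun τ : ℍ ↦ Function.Periodic.qParam m τ ^ (m : ℤ) := by
  simp only [zpow_natCast, ← qParam_one_eq_pow hm]
  exact (Asymptotics.isTheta_of_div_tendsto_nhds_ne_zero tendsto_discriminant_div_qParam
    one_ne_zero).symm

lemma isTheta_jInv_sub {m : ℕ} (hm : m ≠ 0) (c : ℂ) :
    (fun τ ↦ jInv τ - c) =Θ[atImInfty]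
      fun τ : ℍ ↦ Function.Periodic.qParam m τ ^ (-m : ℤ) := by
  simp only [zpow_neg, zpow_natCast, ← qParam_one_eq_pow hm]
  have hq := (qParam_tendsto_atImInfty one_pos).const_mul c
  refine (Asymptotics.isTheta_of_div_tendsto_nhds_ne_zero (c := 1) ?_ one_ne_zero).symm
  simpa [sub_mul, div_eq_mul_inv] using tendsto_jInv_mul_qParam.sub hq

/-! ### Degrees of modular functions for `Γ(m)` -/

/-- The class of `τ` in `Γ(m) \ ℍ`. -/
noncomputable abbrev orbitClass (m : ℕ) (τ : ℍ) : MulAction.orbitRel.Quotient (Gamma m) ℍ :=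
  Quotient.mk _ τ

lemma orbitClass_eq_iff {m : ℕ} {τ σ : ℍ} :
    orbitClass m τ = orbitClass m σ ↔ ∃ γ ∈ signedGamma m, γ • τ = σ := by
  rw [eq_comm, Quotient.eq]
  constructor
  · rintro ⟨γ, rfl⟩
    exact ⟨γ, mem_signedGamma.mpr (.inl γ.2), rfl⟩
  · rintro ⟨γ, hγ, rfl⟩
    obtain ⟨γ', hγ', hsmul⟩ := exists_mem_Gamma_smul_eq hγ
    exact ⟨⟨γ', hγ'⟩, hsmul τ⟩

lemma order_jInv_sub_eq_ncard {m : ℕ} (hm : 2 ≤ m) (τ σ : ℍ) :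
    meromorphicOrderAt ((fun τ' ↦ jInv τ' - jInv σ) ∘ ofComplex) τ =
      ({x : SL(2, ℤ) ⧸ signedGamma m | orbitClass m (x.out • τ) = orbitClass m σ}.ncard : ℤ) := by
  by_cases hγ : ∃ γ : SL(2, ℤ), γ • τ = σ
  · obtain ⟨γ, rfl⟩ := hγ
    have hset : {x : SL(2, ℤ) ⧸ signedGamma m | orbitClass m (x.out • τ) = orbitClass m (γ • τ)} =
        {x | ∃ γ' ∈ signedGamma m, γ⁻¹ * γ' * x.out ∈ MulAction.stabilizer SL(2, ℤ) τ} := by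
      ext x
      simp only [Set.mem_ofPred_eq, orbitClass_eq_iff, MulAction.mem_stabilizer_iff, mul_assoc,
        mul_smul, inv_smul_eq_iff]
    obtain ⟨k, hk, hord⟩ := exists_order_jInv_sub_self τ
    have hcard := card_map_mk'_mul_card_inf (signedGamma m) (MulAction.stabilizer SL(2, ℤ) τ)
    rw [card_signedGamma_inf_stabilizer hm] at hcard
    rw [hset, ncard_setOf_exists_mul_out_mem, jInv_smul,
      show Nat.card _ = k from mul_right_cancel₀ two_ne_zero (by omega)]
    exact hord
  · have hset : {x : SL(2, ℤ) ⧸ signedGamma m | orbitClass m (x.out • τ) = orbitClass m σ} = ∅ :=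
      Set.eq_empty_of_forall_notMem fun x hx ↦ by
        obtain ⟨γ, -, h⟩ := orbitClass_eq_iff.mp hx
        exact hγ ⟨γ * x.out, by rw [mul_smul, h]⟩
    rw [hset, Set.ncard_empty]
    exact order_jInv_sub_eq_zero (not_exists.mp hγ)

lemma apply_out_smul {m : ℕ} {f : ℍ → ℂ} (hinv : ∀ γ ∈ Gamma m, ∀ τ, f (γ • τ) = f τ)
    (g : SL(2, ℤ)) (τ : ℍ) : f ((g : SL(2, ℤ) ⧸ signedGamma m).out • τ) = f (g • τ) := by
  have hmem := (instNormalSignedGamma m).mem_comm (QuotientGroup.eq.mp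
    (QuotientGroup.out_eq' (g : SL(2, ℤ) ⧸ signedGamma m)))
  obtain ⟨γ, hγ, hsmul⟩ := exists_mem_Gamma_smul_eq hmem
  rw [← hinv γ hγ, hsmul, smul_smul, inv_mul_cancel_right]

lemma prod_apply_out_smul_smul {m : ℕ} [Fintype (SL(2, ℤ) ⧸ signedGamma m)] {f : ℍ → ℂ}
    (hinv : ∀ γ ∈ Gamma m, ∀ τ, f (γ • τ) = f τ) (γ : SL(2, ℤ)) (τ : ℍ) :
    ∏ x : SL(2, ℤ) ⧸ signedGamma m, f (x.out • γ • τ) =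
      ∏ x : SL(2, ℤ) ⧸ signedGamma m, f (x.out • τ) := by
  rw [← Equiv.prod_comp (Equiv.mulRight (γ : SL(2, ℤ) ⧸ signedGamma m)) fun x ↦ f (x.out • τ)]
  refine Finset.prod_congr rfl fun x _ ↦ ?_
  have hx : Equiv.mulRight (γ : SL(2, ℤ) ⧸ signedGamma m) x = ((x.out * γ : SL(2, ℤ)) : _ ⧸ _) := by
    rw [QuotientGroup.mk_mul, QuotientGroup.out_eq', Equiv.coe_mulRight]
  rw [hx, apply_out_smul hinv, mul_smul]

lemma prod_zpow_eq_zpow_sum {ι : Type*} (s : Finset ι) {a : ℂ} (ha : a ≠ 0) (k : ι → ℤ) :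
    ∏ i ∈ s, a ^ k i = a ^ ∑ i ∈ s, k i := by
  classical
  induction s using Finset.induction with
  | empty => simp
  | insert i s hi ih => rw [Finset.prod_insert hi, Finset.sum_insert hi, zpow_add₀ ha, ih]

lemma meromorphicAt_comp_SL_smul {f : ℍ → ℂ} {γ : SL(2, ℤ)} {τ : ℍ}
    (hf : MeromorphicAt (f ∘ ofComplex) ((γ • τ : ℍ) : ℂ)) :
    MeromorphicAt ((fun σ ↦ f (γ • σ)) ∘ ofComplex) τ := by
  rw [comp_SL_smul_comp_ofComplex]
  refine MeromorphicAt.comp_analyticAt ?_ (analyticAt_smul (det_SL_coe_pos γ) τ)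
  rwa [ofComplex_apply]

lemma sum_comp_eq_sum_ncard_mul {ι κ : Type*} [Fintype ι] (c : ι → κ) (S : Finset κ) {g : κ → ℤ}
    (hS : ∀ q ∉ S, g q = 0) : ∑ x, g (c x) = ∑ q ∈ S, ({x | c x = q}.ncard : ℤ) * g q := by
  classical
  calc ∑ x, g (c x) = ∑ x, ∑ q ∈ S, if c x = q then g q else 0 :=
        Finset.sum_congr rfl fun x _ ↦ by
          rw [Finset.sum_ite_eq]
          exact (ite_eq_left_iff.mpr fun h ↦ (hS _ h).symm).symm
    _ = ∑ q ∈ S, ({x | c x = q}.ncard : ℤ) * g q := by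
        rw [Finset.sum_comm]
        refine Finset.sum_congr rfl fun q _ ↦ ?_
        rw [← Finset.sum_filter, Finset.sum_const, nsmul_eq_mul, Set.ncard_eq_toFinset_card',
          Set.toFinset_ofPred]

/-- The norm from `Γ(m)` to `SL(2, ℤ)` of the function `f`, divided by the power product of the
functions `j - j(q)` which has the same divisor as this norm in the upper half-plane if `ord` is
the divisor of `f` and `S` contains its support. -/
noncomputable def reducedNorm (m : ℕ) [Fintype (SL(2, ℤ) ⧸ signedGamma m)] (f : ℍ → ℂ)
    (ord : MulAction.orbitRel.Quotient (Gamma m) ℍ → ℤ)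
    (S : Finset (MulAction.orbitRel.Quotient (Gamma m) ℍ)) (τ : ℍ) : ℂ :=
  (∏ x : SL(2, ℤ) ⧸ signedGamma m, f (x.out • τ)) * ∏ q ∈ S, (jInv τ - jInv q.out) ^ (-ord q)

section Degree

variable {m : ℕ} [Fintype (SL(2, ℤ) ⧸ signedGamma m)] {f : ℍ → ℂ}
  {ord : MulAction.orbitRel.Quotient (Gamma m) ℍ → ℤ}
  {S : Finset (MulAction.orbitRel.Quotient (Gamma m) ℍ)}

lemma reducedNorm_smul (hinv : ∀ γ ∈ Gamma m, ∀ τ, f (γ • τ) = f τ) (γ : SL(2, ℤ)) (τ : ℍ) :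
    reducedNorm m f ord S (γ • τ) = reducedNorm m f ord S τ := by
  simp only [reducedNorm, prod_apply_out_smul_smul hinv, jInv_smul]

lemma meromorphicAt_and_order_reducedNorm (hm : 2 ≤ m)
    (hmer : ∀ τ : ℍ, MeromorphicAt (f ∘ ofComplex) τ)
    (hord : ∀ τ : ℍ, meromorphicOrderAt (f ∘ ofComplex) τ = ord (orbitClass m τ))
    (hS : ∀ q ∉ S, ord q = 0) (τ : ℍ) :
    MeromorphicAt (reducedNorm m f ord S ∘ ofComplex) τ ∧
      meromorphicOrderAt (reducedNorm m f ord S ∘ ofComplex) τ = 0 := by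
  set F : SL(2, ℤ) ⧸ signedGamma m → ℂ → ℂ := fun x ↦ (fun σ ↦ f (x.out • σ)) ∘ ofComplex
  set J : MulAction.orbitRel.Quotient (Gamma m) ℍ → ℂ → ℂ :=
    fun q ↦ (fun σ ↦ jInv σ - jInv q.out) ∘ ofComplex
  have hF (x) : MeromorphicAt (F x) τ := meromorphicAt_comp_SL_smul (hmer _)
  have hJ (q) : MeromorphicAt (J q) τ := (analyticAt_jInv τ).meromorphicAt.sub (.const _ _)
  have hordF (x) : meromorphicOrderAt (F x) τ = ord (orbitClass m (x.out • τ)) :=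
    (meromorphicOrderAt_comp_SL_smul f _ τ).trans (hord _)
  have hordJ (q) : meromorphicOrderAt (J q ^ (-ord q)) τ =
      (-(({x : SL(2, ℤ) ⧸ signedGamma m | orbitClass m (x.out • τ) = q}.ncard : ℤ) *
        ord q) : ℤ) := by
    have hq : orbitClass m q.out = q := Quotient.out_eq q
    rw [meromorphicOrderAt_zpow (hJ q), order_jInv_sub_eq_ncard hm, hq, ← WithTop.coe_mul,
      neg_mul, mul_comm]
  have heq : reducedNorm m f ord S ∘ ofComplex = (∏ x, F x) * ∏ q ∈ S, J q ^ (-ord q) := by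
    ext z
    simp [reducedNorm, F, J]
  have hmerF : MeromorphicAt (∏ x, F x) τ := MeromorphicAt.prod fun x _ ↦ hF x
  have hmerJ : MeromorphicAt (∏ q ∈ S, J q ^ (-ord q)) τ :=
    MeromorphicAt.prod fun q _ ↦ (hJ q).zpow _
  rw [heq]
  refine ⟨hmerF.mul hmerJ, ?_⟩
  rw [meromorphicOrderAt_mul hmerF hmerJ, meromorphicOrderAt_prod fun x _ ↦ hF x,
    meromorphicOrderAt_prod fun q _ ↦ (hJ q).zpow _]
  simp only [hordF, hordJ]
  rw [← WithTop.coe_sum, ← WithTop.coe_sum, sum_comp_eq_sum_ncard_mul _ S hS,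
    Finset.sum_neg_distrib, ← WithTop.coe_add, add_neg_cancel, WithTop.coe_zero]

lemma isTheta_reducedNorm (hm : m ≠ 0) {e : SL(2, ℤ) ⧸ signedGamma m → ℤ}
    (he : ∀ x : SL(2, ℤ) ⧸ signedGamma m, (fun τ ↦ f (x.out • τ)) =Θ[atImInfty]
      fun τ : ℍ ↦ Function.Periodic.qParam m τ ^ e x) :
    reducedNorm m f ord S =Θ[atImInfty]
      fun τ : ℍ ↦ Function.Periodic.qParam m τ ^ (∑ x, e x + m * ∑ q ∈ S, ord q) := by
  refine ((Asymptotics.IsTheta.finsetProd fun x _ ↦ he x).mul (Asymptotics.IsTheta.finsetProd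
    fun q _ ↦ (isTheta_jInv_sub hm (jInv q.out)).zpow (-ord q))).trans_eventuallyEq
    (.of_forall fun τ ↦ ?_)
  have hq := Function.Periodic.qParam_ne_zero (h := m) (τ : ℂ)
  simp only [← zpow_mul, neg_mul_neg, prod_zpow_eq_zpow_sum _ hq, ← zpow_add₀ hq, Finset.mul_sum]

/-- The divisor of a modular function for `Γ(m)` has degree zero; the value at `x` of `e` is the
order at the cusp `x ∞`, and each cusp is counted `m` times. -/
theorem sum_exponent_add_sum_order (hm : 2 ≤ m) (hinv : ∀ γ ∈ Gamma m, ∀ τ, f (γ • τ) = f τ)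
    (hmer : ∀ τ : ℍ, MeromorphicAt (f ∘ ofComplex) τ)
    (hord : ∀ τ : ℍ, meromorphicOrderAt (f ∘ ofComplex) τ = ord (orbitClass m τ))
    (hS : ∀ q ∉ S, ord q = 0) {e : SL(2, ℤ) ⧸ signedGamma m → ℤ}
    (he : ∀ x : SL(2, ℤ) ⧸ signedGamma m, (fun τ ↦ f (x.out • τ)) =Θ[atImInfty]
      fun τ : ℍ ↦ Function.Periodic.qParam m τ ^ e x) :
    ∑ x, e x + m * ∑ q ∈ S, ord q = 0 :=
  have hΦ := meromorphicAt_and_order_reducedNorm hm hmer hord hS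
  exponent_eq_zero (two_pos.trans_le hm) (reducedNorm_smul hinv) (fun τ ↦ (hΦ τ).1)
    (fun τ ↦ (hΦ τ).2) (isTheta_reducedNorm (by omega) he)

end Degree

/-! ### The Schwarz derivative -/

lemma schwarzDeriv_eq {F L : ℂ → ℂ} {z L' : ℂ}
    (h : (fun w ↦ deriv (deriv F) w / deriv F w) =ᶠ[𝓝 z] L) (hL : HasDerivAt L L' z) :
    schwarzDeriv F z = L' - 1 / 2 * L z ^ 2 := by
  rw [schwarzDeriv, h.deriv_eq, hL.deriv, h.eq_of_nhds]

lemma schwarzDeriv_congr {F G : ℂ → ℂ} {z : ℂ} (h : F =ᶠ[𝓝 z] G) :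
    schwarzDeriv F z = schwarzDeriv G z := by
  have hlog : (fun w ↦ deriv (deriv F) w / deriv F w) =ᶠ[𝓝 z]
      fun w ↦ deriv (deriv G) w / deriv G w := h.deriv.deriv.div h.deriv
  rw [schwarzDeriv, hlog.deriv_eq, h.deriv.deriv_eq, h.deriv_eq, schwarzDeriv]

lemma schwarzDeriv_eq_zero {F : ℂ → ℂ} {z : ℂ} (h : deriv F =ᶠ[𝓝 z] 0) :
    schwarzDeriv F z = 0 := by
  rw [schwarzDeriv_eq (L := 0) (h.mono fun w hw ↦ by simp [hw]) (hasDerivAt_const _ _)]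
  simp

lemma schwarzDeriv_comp {F G : ℂ → ℂ} {z : ℂ} (hF : AnalyticAt ℂ F (G z))
    (hF' : deriv F (G z) ≠ 0) (hG : AnalyticAt ℂ G z) (hG' : deriv G z ≠ 0) :
    schwarzDeriv (F ∘ G) z = schwarzDeriv F (G z) * deriv G z ^ 2 + schwarzDeriv G z := by
  set A : ℂ → ℂ := fun w ↦ deriv (deriv F) w / deriv F w
  set B : ℂ → ℂ := fun w ↦ deriv (deriv G) w / deriv G w
  have hA : HasDerivAt A (deriv A (G z)) (G z) :=
    (hF.deriv.deriv.div hF.deriv hF').differentiableAt.hasDerivAt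
  have hB : HasDerivAt B (deriv B z) z :=
    (hG.deriv.deriv.div hG.deriv hG').differentiableAt.hasDerivAt
  have hev : ∀ᶠ w in 𝓝 z, (AnalyticAt ℂ F (G w) ∧ deriv F (G w) ≠ 0) ∧
      AnalyticAt ℂ G w ∧ deriv G w ≠ 0 :=
    (hG.continuousAt.eventually (hF.eventually_analyticAt.and
      (hF.deriv.continuousAt.eventually_ne hF'))).and
      (hG.eventually_analyticAt.and (hG.deriv.continuousAt.eventually_ne hG'))
  have hderiv : deriv (F ∘ G) =ᶠ[𝓝 z] fun w ↦ deriv F (G w) * deriv G w :=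
    hev.mono fun w ⟨⟨hFw, _⟩, hGw, _⟩ ↦ deriv_comp w hFw.differentiableAt hGw.differentiableAt
  have hlog : (fun w ↦ deriv (deriv (F ∘ G)) w / deriv (F ∘ G) w) =ᶠ[𝓝 z]
      fun w ↦ A (G w) * deriv G w + B w := by
    filter_upwards [hev, hderiv.eventuallyEq_nhds] with w ⟨⟨hFw, hFw'⟩, hGw, hGw'⟩ hw
    have hderiv₂ : HasDerivAt (fun w ↦ deriv F (G w) * deriv G w)
        (deriv (deriv F) (G w) * deriv G w * deriv G w + deriv F (G w) * deriv (deriv G) w) w :=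
      (hFw.deriv.differentiableAt.hasDerivAt.comp w hGw.differentiableAt.hasDerivAt).fun_mul
        hGw.deriv.differentiableAt.hasDerivAt
    rw [hw.deriv_eq, hw.eq_of_nhds, hderiv₂.deriv]
    simp only [A, B]
    field_simp
  rw [schwarzDeriv_eq hlog (((hA.comp z hG.differentiableAt.hasDerivAt).mul
    hG.deriv.differentiableAt.hasDerivAt).add hB), schwarzDeriv, schwarzDeriv]
  simp only [A, B, Function.comp_apply]
  field_simp
  ring

lemma eventually_eventually_nhdsNE {p : ℂ} {P : ℂ → Prop} (h : ∀ᶠ z in 𝓝[≠] p, P z) :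
    ∀ᶠ z in 𝓝[≠] p, ∀ᶠ w in 𝓝 z, P w :=
  (eventually_nhdsWithin_eventually_nhds_iff_of_isOpen isOpen_compl_singleton).mpr h

lemma deriv_div_zpow_mul_eq {g D : ℂ → ℂ} {p z : ℂ} {l : ℤ} (hz : z ≠ p)
    (hg : AnalyticAt ℂ g z) (hgz : g z ≠ 0) (hD : D =ᶠ[𝓝 z] fun w ↦ (w - p) ^ l * g w) :
    deriv D z / D z = l / (z - p) + deriv g z / g z := by
  have hzp : z - p ≠ 0 := sub_ne_zero.mpr hz
  have hzpow : HasDerivAt (fun w ↦ (w - p) ^ l) (l * (z - p) ^ (l - 1)) z :=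
    (hasDerivAt_zpow l (z - p) (.inl hzp)).comp_sub_const z p
  have hprod := hzpow.fun_mul hg.differentiableAt.hasDerivAt
  have hpow := zpow_ne_zero l hzp
  rw [hD.deriv_eq, hprod.deriv, hD.eq_of_nhds, zpow_sub_one₀ hzp]
  field_simp

lemma tendsto_sq_mul_schwarzDeriv {F : ℂ → ℂ} {p : ℂ} (hF : MeromorphicAt F p) {l : ℤ}
    (hl : meromorphicOrderAt (deriv F) p = l) :
    Tendsto (fun z ↦ (z - p) ^ 2 * schwarzDeriv F z) (𝓝[≠] p) (𝓝 (-(l * (l + 2) / 2))) := by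
  obtain ⟨g, hg, hgp, hDg⟩ := (meromorphicOrderAt_eq_int_iff hF.deriv).mp hl
  set u : ℂ → ℂ := fun z ↦ deriv g z / g z
  have hu : AnalyticAt ℂ u p := hg.deriv.div hg hgp
  have hev : ∀ᶠ z in 𝓝[≠] p, z ≠ p ∧ AnalyticAt ℂ g z ∧ g z ≠ 0 ∧ AnalyticAt ℂ u z ∧
      deriv F z = (z - p) ^ l * g z := by
    filter_upwards [self_mem_nhdsWithin, hg.eventually_analyticAt.filter_mono nhdsWithin_le_nhds,
      (hg.continuousAt.eventually_ne hgp).filter_mono nhdsWithin_le_nhds,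
      hu.eventually_analyticAt.filter_mono nhdsWithin_le_nhds, hDg] with z h1 h2 h3 h4 h5
    exact ⟨h1, h2, h3, h4, h5⟩
  have heq : (fun z ↦ -l + (z - p) ^ 2 * deriv u z - 1 / 2 * (l + (z - p) * u z) ^ 2)
      =ᶠ[𝓝[≠] p] fun z ↦ (z - p) ^ 2 * schwarzDeriv F z := by
    filter_upwards [eventually_eventually_nhdsNE hev] with z hz
    have hzp : z - p ≠ 0 := sub_ne_zero.mpr hz.self_of_nhds.1
    have hlog : (fun w ↦ deriv (deriv F) w / deriv F w) =ᶠ[𝓝 z] fun w ↦ l / (w - p) + u w := by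
      filter_upwards [hz, hz.eventually_nhds] with w ⟨hwp, hgw, hgw0, _, _⟩ hw
      exact deriv_div_zpow_mul_eq hwp hgw hgw0 (hw.mono fun _ h ↦ h.2.2.2.2)
    have hpole : HasDerivAt (fun w ↦ (l : ℂ) / (w - p)) (-l / (z - p) ^ 2) z := by
      simpa using (hasDerivAt_const z (l : ℂ)).fun_div ((hasDerivAt_id' z).sub_const p) hzp
    rw [schwarzDeriv_eq hlog
      (hpole.add hz.self_of_nhds.2.2.2.1.differentiableAt.hasDerivAt)]
    field_simp
  have hlim : ContinuousAt
      (fun z ↦ -l + (z - p) ^ 2 * deriv u z - 1 / 2 * (l + (z - p) * u z) ^ 2) p := by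
    have := hu.continuousAt
    have := hu.deriv.continuousAt
    fun_prop
  convert (hlim.tendsto.mono_left nhdsWithin_le_nhds).congr' heq using 2
  ring

lemma meromorphicOrderAt_neg_iff {F : ℂ → ℂ} {p : ℂ} (hF : MeromorphicAt F p) {l : ℤ}
    (hl : meromorphicOrderAt (deriv F) p = l) : meromorphicOrderAt F p < 0 ↔ l + 1 < 0 := by
  refine ⟨fun hneg ↦ ?_, fun hlneg ↦ ?_⟩
  · obtain ⟨k, hk⟩ := WithTop.ne_top_iff_exists.mp (ne_top_of_lt hneg)
    rw [← hk, WithTop.coe_lt_zero] at hneg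
    have hderiv := meromorphicOrderAt_deriv_eq_sub_one (n := k) (by exact_mod_cast hneg.ne) hk.symm
    rw [hl, WithTop.coe_inj] at hderiv
    omega
  · by_contra hpos
    obtain ⟨G, hG, hFG⟩ := hF.meromorphicOrderAt_nonneg_iff.mp (not_lt.mp hpos)
    have hderiv : deriv F =ᶠ[𝓝[≠] p] deriv G :=
      (eventually_eventually_nhdsNE hFG).mono fun z hz ↦ EventuallyEq.deriv_eq hz
    have hnonneg := hG.deriv.meromorphicOrderAt_nonneg
    rw [← meromorphicOrderAt_congr hderiv, hl] at hnonneg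
    have : 0 ≤ l := by exact_mod_cast hnonneg
    omega

/-- The indicial equation of the Schwarz equation at a point where its right-hand side is
continuous reads `l (l + 2) = 0`. -/
lemma meromorphicOrderAt_deriv_of_schwarzDeriv_eq {F E : ℂ → ℂ} {p : ℂ} (hF : MeromorphicAt F p)
    (hE : ContinuousAt E p) (hE0 : ∃ᶠ z in 𝓝[≠] p, E z ≠ 0)
    (hS : schwarzDeriv F =ᶠ[𝓝[≠] p] E) [Decidable (meromorphicOrderAt F p < 0)] :
    meromorphicOrderAt (deriv F) p = (if meromorphicOrderAt F p < 0 then -2 else 0 : ℤ) := by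
  have hne : meromorphicOrderAt (deriv F) p ≠ ⊤ := fun htop ↦ by
    rw [meromorphicOrderAt_eq_top_iff] at htop
    obtain ⟨z, hz, hz', hEz⟩ :=
      (hE0.and_eventually ((eventually_eventually_nhdsNE htop).and hS)).exists
    exact hz (hEz ▸ schwarzDeriv_eq_zero hz')
  obtain ⟨l, hl⟩ := WithTop.ne_top_iff_exists.mp hne
  have hlim : Tendsto (fun z ↦ (z - p) ^ 2 * E z) (𝓝[≠] p) (𝓝 ((p - p) ^ 2 * E p)) :=
    (((continuousAt_id.sub continuousAt_const).pow 2).mul hE).tendsto.mono_left nhdsWithin_le_nhds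
  have hlim' := (tendsto_sq_mul_schwarzDeriv hF hl.symm).congr'
    (hS.mono fun z hz ↦ congrArg ((z - p) ^ 2 * ·) hz)
  have hindicial : l * (l + 2) = 0 := by
    have : (l : ℂ) * (l + 2) = 0 := by linear_combination 2 * tendsto_nhds_unique hlim hlim'
    exact_mod_cast this
  rw [← hl, WithTop.coe_inj]
  split_ifs with hneg <;> rw [meromorphicOrderAt_neg_iff hF hl.symm] at hneg <;>
    rcases mul_eq_zero.mp hindicial with h | h <;> omega

lemma hasDerivAt_SL_smul (γ : SL(2, ℤ)) (τ : ℍ) :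
    HasDerivAt (fun z ↦ ((γ • ofComplex z : ℍ) : ℂ)) (denom γ τ ^ (-2 : ℤ)) τ := by
  have hderiv := (hasStrictDerivAt_smul (det_SL_coe_pos γ) τ).hasDerivAt
  rw [det_SL_coe, Complex.ofReal_one, one_div, ← zpow_natCast, ← zpow_neg] at hderiv
  exact hderiv

lemma eventually_mem_upperHalfPlane {P : ℂ → Prop} (hP : ∀ τ : ℍ, P τ) (τ : ℍ) :
    ∀ᶠ z in 𝓝 (τ : ℂ), P z := by
  filter_upwards [isOpen_upperHalfPlaneSet.mem_nhds τ.im_pos] with z hz using hP ⟨z, hz⟩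

lemma schwarzDeriv_SL_smul (γ : SL(2, ℤ)) (τ : ℍ) :
    schwarzDeriv (fun z ↦ ((γ • ofComplex z : ℍ) : ℂ)) τ = 0 := by
  set G : ℂ → ℂ := fun z ↦ ((γ • ofComplex z : ℍ) : ℂ)
  set c : ℂ := (((γ : GL (Fin 2) ℝ) 1 0 : ℝ) : ℂ)
  have hderiv (σ : ℍ) : deriv G =ᶠ[𝓝 (σ : ℂ)] fun z ↦ denom γ z ^ (-2 : ℤ) :=
    eventually_mem_upperHalfPlane (fun σ ↦ (hasDerivAt_SL_smul γ σ).deriv) σ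
  have hlog : (fun z ↦ deriv (deriv G) z / deriv G z) =ᶠ[𝓝 (τ : ℂ)]
      fun z ↦ -2 * c * denom γ z ^ (-1 : ℤ) := by
    refine eventually_mem_upperHalfPlane (fun σ ↦ ?_) τ
    have hne := denom_ne_zero γ σ
    beta_reduce
    rw [(hderiv σ).deriv_eq, deriv_denom_zpow, (hderiv σ).eq_of_nhds]
    simp only [Int.reduceNeg, Int.cast_neg, Int.cast_ofNat, Int.reduceSub, zpow_neg, zpow_ofNat]
    field_simp
    rfl
  rw [schwarzDeriv_eq hlog ((hasDerivAt_denom_zpow γ (-1) τ).const_mul _)]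
  have hne := denom_ne_zero γ τ
  simp only [Int.reduceNeg, Int.cast_neg, Int.cast_one, Int.reduceSub, zpow_neg, zpow_ofNat]
  field_simp
  ring

lemma deriv_comp_SL_smul (f : ℍ → ℂ) (γ : SL(2, ℤ)) (τ : ℍ) :
    deriv ((fun σ ↦ f (γ • σ)) ∘ ofComplex) τ =
      deriv (f ∘ ofComplex) ((γ • τ : ℍ) : ℂ) * denom γ τ ^ (-2 : ℤ) := by
  have hderiv (f : ℍ → ℂ) (γ : SL(2, ℤ)) (τ : ℍ)
      (hf : DifferentiableAt ℂ (f ∘ ofComplex) ((γ • τ : ℍ) : ℂ)) :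
      HasDerivAt ((fun σ ↦ f (γ • σ)) ∘ ofComplex)
        (deriv (f ∘ ofComplex) ((γ • τ : ℍ) : ℂ) * denom γ τ ^ (-2 : ℤ)) τ := by
    rw [comp_SL_smul_comp_ofComplex]
    refine HasDerivAt.comp (τ : ℂ) ?_ (hasDerivAt_SL_smul γ τ)
    rw [ofComplex_apply]
    exact hf.hasDerivAt
  by_cases hf : DifferentiableAt ℂ (f ∘ ofComplex) ((γ • τ : ℍ) : ℂ)
  · exact (hderiv f γ τ hf).deriv
  · rw [deriv_zero_of_not_differentiableAt hf, zero_mul, deriv_zero_of_not_differentiableAt]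
    intro hfγ
    have hinv := hderiv (fun σ ↦ f (γ • σ)) γ⁻¹ (γ • τ) (by rwa [inv_smul_smul])
    simp only [smul_inv_smul] at hinv
    exact hf hinv.differentiableAt

lemma schwarzDeriv_comp_SL_smul {f : ℍ → ℂ} {γ : SL(2, ℤ)} {τ : ℍ}
    (hf : AnalyticAt ℂ (f ∘ ofComplex) ((γ • τ : ℍ) : ℂ))
    (hf' : deriv (f ∘ ofComplex) ((γ • τ : ℍ) : ℂ) ≠ 0) :
    schwarzDeriv ((fun σ ↦ f (γ • σ)) ∘ ofComplex) τ =
      schwarzDeriv (f ∘ ofComplex) ((γ • τ : ℍ) : ℂ) * denom γ τ ^ (-4 : ℤ) := by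
  have hG : AnalyticAt ℂ (fun z ↦ ((γ • ofComplex z : ℍ) : ℂ)) τ :=
    analyticAt_smul (det_SL_coe_pos γ) τ
  have hG' := (hasDerivAt_SL_smul γ τ).deriv
  rw [comp_SL_smul_comp_ofComplex, schwarzDeriv_comp (by rwa [ofComplex_apply])
    (by rwa [ofComplex_apply]) hG (hG' ▸ zpow_ne_zero _ (denom_ne_zero γ τ)),
    schwarzDeriv_SL_smul, add_zero, hG', ofComplex_apply, ← zpow_natCast, ← zpow_mul]
  norm_num

lemma hasDerivAt_qParam (m : ℕ) (z : ℂ) :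
    HasDerivAt (Function.Periodic.qParam m)
      (2 * Real.pi * Complex.I / m * Function.Periodic.qParam m z) z := by
  have hlin : HasDerivAt (fun z : ℂ ↦ 2 * Real.pi * Complex.I * z / (m : ℝ))
      (2 * Real.pi * Complex.I * 1 / (m : ℝ)) z := ((hasDerivAt_id z).const_mul _).div_const _
  convert! hlin.cexp using 1
  simp only [Function.Periodic.qParam, Complex.ofReal_natCast, mul_one]
  ring

lemma deriv_qParam (m : ℕ) :
    deriv (Function.Periodic.qParam m) =
      fun z ↦ 2 * Real.pi * Complex.I / m * Function.Periodic.qParam m z :=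
  funext fun z ↦ (hasDerivAt_qParam m z).deriv

lemma schwarzDeriv_qParam {m : ℕ} (hm : m ≠ 0) (z : ℂ) :
    schwarzDeriv (Function.Periodic.qParam m) z = 2 * Real.pi ^ 2 / m ^ 2 := by
  have hlog : (fun w ↦ deriv (deriv (Function.Periodic.qParam m)) w /
      deriv (Function.Periodic.qParam m) w) = fun _ ↦ 2 * Real.pi * Complex.I / m := by
    ext w
    have hq := Function.Periodic.qParam_ne_zero (h := m) w
    rw [deriv_qParam, deriv_const_mul _ (hasDerivAt_qParam m w).differentiableAt, deriv_qParam]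
    field_simp
  rw [schwarzDeriv_eq hlog.eventuallyEq (hasDerivAt_const _ _)]
  ring_nf
  rw [Complex.I_sq]
  ring

lemma tendsto_qParam_nhdsNE {m : ℕ} (hm : m ≠ 0) :
    Tendsto (fun τ : ℍ ↦ Function.Periodic.qParam m τ) atImInfty (𝓝[≠] 0) :=
  (Function.Periodic.qParam_tendsto (Nat.cast_pos.mpr hm.bot_lt)).comp tendsto_coe_atImInfty

section Cusp

variable {m : ℕ} {f : ℍ → ℂ} {F : ℂ → ℂ}

lemma comp_ofComplex_eventuallyEq (hf : ∀ τ : ℍ, f τ = F (Function.Periodic.qParam m τ)) (τ : ℍ) :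
    f ∘ ofComplex =ᶠ[𝓝 (τ : ℂ)] F ∘ Function.Periodic.qParam m :=
  eventually_mem_upperHalfPlane (fun σ ↦ by rw [Function.comp_apply, ofComplex_apply, hf]; rfl) τ

lemma deriv_comp_ofComplex_of_qParam (hf : ∀ τ : ℍ, f τ = F (Function.Periodic.qParam m τ)) {τ : ℍ}
    (hF : AnalyticAt ℂ F (Function.Periodic.qParam m τ)) :
    deriv (f ∘ ofComplex) τ = 2 * Real.pi * Complex.I / m *
      (Function.Periodic.qParam m τ * deriv F (Function.Periodic.qParam m τ)) := by
  rw [(comp_ofComplex_eventuallyEq hf τ).deriv_eq,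
    (hF.differentiableAt.hasDerivAt.comp _ (hasDerivAt_qParam m τ)).deriv]
  ring

lemma schwarzDeriv_comp_ofComplex_of_qParam (hm : m ≠ 0)
    (hf : ∀ τ : ℍ, f τ = F (Function.Periodic.qParam m τ)) {τ : ℍ}
    (hF : AnalyticAt ℂ F (Function.Periodic.qParam m τ))
    (hF' : deriv F (Function.Periodic.qParam m τ) ≠ 0) :
    schwarzDeriv (f ∘ ofComplex) τ = 2 * Real.pi ^ 2 / m ^ 2 *
      (1 - 2 * (Function.Periodic.qParam m τ ^ 2 *
        schwarzDeriv F (Function.Periodic.qParam m τ))) := by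
  have hq' : deriv (Function.Periodic.qParam m) (τ : ℂ) ≠ 0 := by
    simp [deriv_qParam, hm, Complex.I_ne_zero, Real.pi_ne_zero,
      Function.Periodic.qParam_ne_zero]
  rw [schwarzDeriv_congr (comp_ofComplex_eventuallyEq hf τ), schwarzDeriv_comp hF hF'
    (Function.Periodic.differentiable_qParam.analyticAt _) hq', schwarzDeriv_qParam hm,
    deriv_qParam]
  linear_combination (norm := ring_nf) (schwarzDeriv F (Function.Periodic.qParam m τ) *
    4 * Real.pi ^ 2 / m ^ 2 * Function.Periodic.qParam m τ ^ 2) * Complex.I_sq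

/-- The exponents at a cusp of the solutions of the Schwarz equation with limit
`2 π² (k / m)²` are `± k`. -/
lemma tendsto_schwarzDeriv_atImInfty (hm : m ≠ 0) (hF : MeromorphicAt F 0)
    (hf : ∀ τ : ℍ, f τ = F (Function.Periodic.qParam m τ)) {l : ℤ}
    (hl : meromorphicOrderAt (deriv F) 0 = l) :
    Tendsto (fun τ : ℍ ↦ schwarzDeriv (f ∘ ofComplex) τ) atImInfty
      (𝓝 (2 * Real.pi ^ 2 * ((l + 1) / m) ^ 2)) := by
  have hne : ∀ᶠ w in 𝓝[≠] 0, deriv F w ≠ 0 :=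
    (meromorphicOrderAt_ne_top_iff_eventually_ne_zero hF.deriv).mp (by simp [hl])
  have hlim := (((tendsto_sq_mul_schwarzDeriv hF hl).comp (tendsto_qParam_nhdsNE hm)).const_mul
    2).const_sub 1 |>.const_mul (2 * Real.pi ^ 2 / m ^ 2 : ℂ)
  have heq : ∀ᶠ τ : ℍ in atImInfty, 2 * Real.pi ^ 2 / m ^ 2 *
      (1 - 2 * ((Function.Periodic.qParam m τ - 0) ^ 2 *
        schwarzDeriv F (Function.Periodic.qParam m τ))) = schwarzDeriv (f ∘ ofComplex) τ := by
    filter_upwards [(tendsto_qParam_nhdsNE hm).eventually (hF.eventually_analyticAt.and hne)]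
      with τ ⟨hτ, hτ'⟩
    rw [schwarzDeriv_comp_ofComplex_of_qParam hm hf hτ hτ', sub_zero]
  convert hlim.congr' heq using 2
  ring

lemma isTheta_deriv_comp_ofComplex (hm : m ≠ 0) (hF : MeromorphicAt F 0)
    (hf : ∀ τ : ℍ, f τ = F (Function.Periodic.qParam m τ)) {l : ℤ}
    (hl : meromorphicOrderAt (deriv F) 0 = l) :
    (fun τ : ℍ ↦ deriv (f ∘ ofComplex) τ) =Θ[atImInfty]
      fun τ : ℍ ↦ Function.Periodic.qParam m τ ^ (l + 1) := by
  obtain ⟨g, hg, hg0, hFg⟩ := (meromorphicOrderAt_eq_int_iff hF.deriv).mp hl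
  set c : ℂ := 2 * Real.pi * Complex.I / m
  have hc : c ≠ 0 := by simp [c, hm, Complex.I_ne_zero, Real.pi_ne_zero]
  refine (Asymptotics.isTheta_of_div_tendsto_nhds_ne_zero (c := c * g 0) ?_
    (mul_ne_zero hc hg0)).symm
  have hlim := ((hg.continuousAt.tendsto.mono_left nhdsWithin_le_nhds).comp
    (tendsto_qParam_nhdsNE hm)).const_mul c
  refine hlim.congr' ?_
  filter_upwards [(tendsto_qParam_nhdsNE hm).eventually (hF.eventually_analyticAt.and hFg)]
    with τ ⟨hτ, hτ'⟩
  have hq := Function.Periodic.qParam_ne_zero (h := m) (τ : ℂ)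
  rw [deriv_comp_ofComplex_of_qParam hf hτ, hτ', sub_zero, zpow_add_one₀ hq, smul_eq_mul]
  field_simp [zpow_ne_zero l hq]
  simp only [c, Function.comp_apply]
  field_simp

lemma meromorphicOrderAt_deriv_ne_top_of_frequently (hm : m ≠ 0) (hF : MeromorphicAt F 0)
    (hf : ∀ τ : ℍ, f τ = F (Function.Periodic.qParam m τ))
    (hne : ∃ᶠ τ : ℍ in atImInfty, deriv (f ∘ ofComplex) τ ≠ 0) :
    meromorphicOrderAt (deriv F) 0 ≠ ⊤ := fun htop ↦ by
  obtain ⟨τ, hτ, hF', hFan⟩ := (hne.and_eventually ((tendsto_qParam_nhdsNE hm).eventually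
    ((meromorphicOrderAt_eq_top_iff.mp htop).and hF.eventually_analyticAt))).exists
  exact hτ (by rw [deriv_comp_ofComplex_of_qParam hf hFan, hF', mul_zero, mul_zero])

end Cusp

/-! ### Poles of modular functions -/

section Poles

variable {m : ℕ} {h : ℍ → ℂ}

lemma IsModularFunction.meromorphicAt (hmod : IsModularFunction m h) (τ : ℍ) :
    MeromorphicAt (h ∘ ofComplex) τ :=
  (hmod.meromorphic τ.im_pos).meromorphicAt

lemma IsModularFunction.mul_smul (hmod : IsModularFunction m h) {γ : SL(2, ℤ)}
    (hγ : γ ∈ Gamma m) (δ : SL(2, ℤ)) (τ : ℍ) : h ((δ * γ) • τ) = h (δ • τ) := by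
  rw [← hmod.invariant _ ((Gamma_normal m).conj_mem γ hγ δ) (δ • τ), ← SemigroupAction.mul_smul,
    inv_mul_cancel_right]

lemma IsModularFunction.periodic (hmod : IsModularFunction m h) (γ : SL(2, ℤ)) :
    Function.Periodic ((fun τ ↦ h (γ • τ)) ∘ ofComplex) (m : ℝ) := by
  intro z
  by_cases hz : 0 < z.im
  · have hT : ModularGroup.T ^ (m : ℤ) ∈ Gamma m := by
      simpa using ModularGroup_T_pow_mem_Gamma (m : ℤ) m dvd_rfl
    lift z to ℍ using hz
    have hshift : ofComplex ((z : ℂ) + (m : ℝ)) = ModularGroup.T ^ (m : ℤ) • z := by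
      ext
      rw [ModularGroup.coe_T_zpow_smul_eq, ofComplex_apply_of_im_pos (by simpa using z.im_pos)]
      simp
    rw [Function.comp_apply, hshift, Function.comp_apply, ofComplex_apply,
      ← SemigroupAction.mul_smul, hmod.mul_smul hT]
  · have hshift : ofComplex (z + (m : ℝ)) = ofComplex z := by
      rw [ofComplex_apply_of_im_nonpos (not_lt.mp hz),
        ofComplex_apply_of_im_nonpos (by simpa using not_lt.mp hz)]
    rw [Function.comp_apply, hshift, Function.comp_apply]

lemma IsModularFunction.apply_SL_smul (hmod : IsModularFunction m h) (hm : m ≠ 0) (γ : SL(2, ℤ))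
    (τ : ℍ) : h (γ • τ) = cuspExpansion m h γ (Function.Periodic.qParam m τ) :=
  (UpperHalfPlane.eq_cuspFunction τ (Nat.cast_ne_zero.mpr hm) (hmod.periodic γ)).symm

lemma hasPoleAt_SL_smul_iff (γ : SL(2, ℤ)) (τ : ℍ) :
    HasPoleAt h (γ • τ) ↔ HasPoleAt (fun σ ↦ h (γ • σ)) τ := by
  rw [HasPoleAt, HasPoleAt, ← meromorphicOrderAt_comp_SL_smul]
  rfl

lemma IsModularFunction.hasPoleAt_smul_iff (hmod : IsModularFunction m h) {γ : SL(2, ℤ)}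
    (hγ : γ ∈ Gamma m) (τ : ℍ) : HasPoleAt h (γ • τ) ↔ HasPoleAt h τ := by
  simp only [hasPoleAt_SL_smul_iff, hmod.invariant γ hγ]

lemma IsModularFunction.orbitClass_mem_interiorPoles_iff (hmod : IsModularFunction m h) {τ : ℍ} :
    orbitClass m τ ∈ interiorPoles m h ↔ HasPoleAt h τ := by
  refine ⟨?_, fun hτ ↦ ⟨τ, hτ, rfl⟩⟩
  rintro ⟨σ, hσ, hτσ⟩
  obtain ⟨γ, rfl⟩ := Quotient.exact hτσ
  exact (hmod.hasPoleAt_smul_iff γ.2 σ).mpr hσ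

lemma not_hasPoleAt_of_analyticAt {τ : ℍ} (hτ : AnalyticAt ℂ (h ∘ ofComplex) τ) :
    ¬ HasPoleAt h τ :=
  not_lt.mpr hτ.meromorphicOrderAt_nonneg

lemma IsModularFunction.eventually_not_hasPoleAt (hmod : IsModularFunction m h) (hm : m ≠ 0)
    (γ : SL(2, ℤ)) : ∀ᶠ τ in atImInfty, ¬ HasPoleAt h (γ • τ) := by
  filter_upwards [(tendsto_qParam_nhdsNE hm).eventually
    (hmod.meromorphic_cusps γ).eventually_analyticAt] with τ hτ
  rw [hasPoleAt_SL_smul_iff]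
  refine not_hasPoleAt_of_analyticAt (AnalyticAt.congr ?_
    (comp_ofComplex_eventuallyEq (hmod.apply_SL_smul hm γ) τ).symm)
  exact hτ.comp (Function.Periodic.differentiable_qParam.analyticAt _)

lemma IsModularFunction.finite_setOf_hasPoleAt (hmod : IsModularFunction m h) {K : Set ℍ}
    (hK : IsCompact K) : {τ ∈ K | HasPoleAt h τ}.Finite := by
  by_contra hinf
  obtain ⟨τ, -, hτ⟩ :=
    Set.Infinite.exists_accPt_of_subset_isCompact hinf hK (Set.sep_subset K _)
  obtain ⟨σ, hσ, hσ'⟩ := ((accPt_iff_frequently_nhdsNE.mp hτ).and_eventually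
    ((tendsto_coe_nhdsNE τ).eventually (hmod.meromorphicAt τ).eventually_analyticAt)).exists
  exact not_hasPoleAt_of_analyticAt hσ' hσ.2

theorem IsModularFunction.finite_interiorPoles (hmod : IsModularFunction m h) (hm : m ≠ 0) :
    (interiorPoles m h).Finite := by
  have : NeZero m := ⟨hm⟩
  have : Finite (SL(2, ℤ) ⧸ Gamma m) := Subgroup.finite_quotient_of_finiteIndex
  choose Y hY using fun x : SL(2, ℤ) ⧸ Gamma m ↦
    (atImInfty_mem _).mp (hmod.eventually_not_hasPoleAt hm x.out)
  have hfin : (⋃ x : SL(2, ℤ) ⧸ Gamma m, orbitClass m '' {τ ∈ (fun σ ↦ x.out • σ) ''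
      ModularGroup.truncatedFundamentalDomain (Y x) | HasPoleAt h τ}).Finite :=
    Set.finite_iUnion fun x ↦ (hmod.finite_setOf_hasPoleAt
      ((ModularGroup.isCompact_truncatedFundamentalDomain _).image
        (continuous_SL_smul x.out))).image _
  refine hfin.subset ?_
  rintro _ ⟨τ, hτ, rfl⟩
  obtain ⟨γ, hγ⟩ := ModularGroup.exists_smul_mem_fd τ
  obtain ⟨N, hN⟩ := QuotientGroup.mk_out_eq_mul (Gamma m) γ⁻¹
  have hN' : γ⁻¹ * N * γ ∈ Gamma m := by
    simpa using (Gamma_normal m).conj_mem N N.2 γ⁻¹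
  have hτ' : (QuotientGroup.mk γ⁻¹ : SL(2, ℤ) ⧸ Gamma m).out • γ • τ = (γ⁻¹ * N * γ) • τ := by
    rw [hN, ← SemigroupAction.mul_smul]
  have hpole := (hmod.hasPoleAt_smul_iff hN' τ).mpr hτ
  rw [← hτ'] at hpole
  refine Set.mem_iUnion.mpr ⟨QuotientGroup.mk γ⁻¹, _,
    ⟨⟨γ • τ, ⟨hγ, not_lt.mp fun hlt ↦ hY _ _ hlt.le hpole⟩, rfl⟩, hpole⟩, ?_⟩
  beta_reduce
  rw [hτ']
  exact Quotient.sound ⟨⟨_, hN'⟩, rfl⟩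

/-- This characterization does not involve the local parameter, so it is insensitive to the choice
of `γ` with a given value of `γ ∞`. -/
lemma IsModularFunction.meromorphicOrderAt_cuspExpansion_neg_iff (hmod : IsModularFunction m h)
    (hm : m ≠ 0) (γ : SL(2, ℤ)) : meromorphicOrderAt (cuspExpansion m h γ) 0 < 0 ↔
      Tendsto (fun τ ↦ h (γ • τ)) atImInfty (Bornology.cobounded ℂ) := by
  rw [← tendsto_cobounded_iff_meromorphicOrderAt_neg (hmod.meromorphic_cusps γ)]
  refine ⟨fun hlim ↦ ?_, fun hlim ↦ ?_⟩
  · exact (hlim.comp (tendsto_qParam_nhdsNE hm)).congr fun τ ↦ (hmod.apply_SL_smul hm γ τ).symm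
  · refine ((hlim.comp tendsto_comap_im_ofComplex).comp
      (Function.Periodic.invQParam_tendsto (Nat.cast_pos.mpr hm.bot_lt))).congr' ?_
    filter_upwards [self_mem_nhdsWithin] with q hq
    exact (Function.Periodic.cuspFunction_eq_of_nonzero _ _ hq).symm

lemma tendsto_SL_smul_atImInfty {γ : SL(2, ℤ)} (hγ : γ ∈ stabilizerInfty) :
    Tendsto (fun τ : ℍ ↦ γ • τ) atImInfty atImInfty := by
  refine UpperHalfPlane.tendsto_smul_atImInfty (g := (γ : GL (Fin 2) ℝ)) ?_
  exact OnePoint.smul_infty_eq_self_iff.mp hγ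

lemma mapGL_smul_infty_eq_iff {γ γ' : SL(2, ℤ)} :
    Matrix.SpecialLinearGroup.mapGL ℝ γ • (OnePoint.infty : OnePoint ℝ) =
      Matrix.SpecialLinearGroup.mapGL ℝ γ' • (OnePoint.infty : OnePoint ℝ) ↔
      γ'⁻¹ * γ ∈ stabilizerInfty := by
  rw [stabilizerInfty, Subgroup.mem_comap, MulAction.mem_stabilizer_iff, map_mul, map_inv,
    SemigroupAction.mul_smul, inv_smul_eq_iff]

lemma IsModularFunction.hasPoleAtCusp_smul_infty_iff (hmod : IsModularFunction m h) (hm : m ≠ 0)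
    (γ : SL(2, ℤ)) :
    HasPoleAtCusp m h (Matrix.SpecialLinearGroup.mapGL ℝ γ • (OnePoint.infty : OnePoint ℝ)) ↔
      Tendsto (fun τ ↦ h (γ • τ)) atImInfty (Bornology.cobounded ℂ) := by
  rw [← hmod.meromorphicOrderAt_cuspExpansion_neg_iff hm]
  refine ⟨?_, fun hγ ↦ ⟨γ, rfl, hγ⟩⟩
  rintro ⟨γ', hγ', hpole⟩
  rw [hmod.meromorphicOrderAt_cuspExpansion_neg_iff hm] at hpole ⊢
  refine (hpole.comp (tendsto_SL_smul_atImInfty (mapGL_smul_infty_eq_iff.mp hγ'.symm))).congr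
    fun τ ↦ ?_
  rw [Function.comp_apply, ← SemigroupAction.mul_smul, mul_inv_cancel_left]

/-- The class of the cusp `γ ∞` modulo `Γ(m)`. -/
noncomputable def cuspClass (m : ℕ) [NeZero m] (γ : SL(2, ℤ)) :
    CuspOrbits (Gamma m : Subgroup (GL (Fin 2) ℝ)) :=
  Quotient.mk _ ⟨Matrix.SpecialLinearGroup.mapGL ℝ γ • OnePoint.infty,
    (Subgroup.IsArithmetic.isCusp_iff_isCusp_SL2Z _).mpr (isCusp_SL2Z_iff'.mpr ⟨γ, rfl⟩)⟩

lemma cuspClass_surjective [NeZero m] : Function.Surjective (cuspClass m) := by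
  rintro ⟨c, hc⟩
  obtain ⟨γ, rfl⟩ := isCusp_SL2Z_iff'.mp ((Subgroup.IsArithmetic.isCusp_iff_isCusp_SL2Z _).mp hc)
  exact ⟨γ, rfl⟩

lemma cuspClass_eq_iff [NeZero m] {γ γ' : SL(2, ℤ)} :
    cuspClass m γ = cuspClass m γ' ↔ ∃ N ∈ Gamma m,
      Matrix.SpecialLinearGroup.mapGL ℝ (N * γ) • (OnePoint.infty : OnePoint ℝ) =
        Matrix.SpecialLinearGroup.mapGL ℝ γ' • (OnePoint.infty : OnePoint ℝ) := by
  rw [eq_comm, cuspClass, cuspClass, Quotient.eq]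
  simp only [map_mul, SemigroupAction.mul_smul]
  constructor
  · rintro ⟨⟨_, N, hN, rfl⟩, heq⟩
    exact ⟨N, hN, congrArg Subtype.val heq⟩
  · rintro ⟨N, hN, heq⟩
    exact ⟨⟨_, N, hN, rfl⟩, Subtype.ext heq⟩

lemma cuspClass_eq_iff_exists_mem_signedGamma [NeZero m] {γ γ' : SL(2, ℤ)} :
    cuspClass m γ = cuspClass m γ' ↔ ∃ N ∈ signedGamma m, γ'⁻¹ * N * γ ∈ stabilizerInfty := by
  simp only [cuspClass_eq_iff, mapGL_smul_infty_eq_iff, ← mul_assoc]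
  refine ⟨fun ⟨N, hN, hmem⟩ ↦ ⟨N, mem_signedGamma.mpr (.inl hN), hmem⟩, fun ⟨N, hN, hmem⟩ ↦ ?_⟩
  rcases mem_signedGamma.mp hN with hN | hN
  · exact ⟨N, hN, hmem⟩
  · refine ⟨-N, hN, ?_⟩
    rw [mul_neg, neg_mul, ← neg_one_mul]
    exact mul_mem (mem_stabilizerInfty.mpr ⟨0, .inr rfl⟩) hmem

lemma ncard_setOf_cuspClass_eq [NeZero m]
    (c : CuspOrbits (Gamma m : Subgroup (GL (Fin 2) ℝ))) :
    {x : SL(2, ℤ) ⧸ signedGamma m | cuspClass m x.out = c}.ncard = m := by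
  obtain ⟨γ, rfl⟩ := cuspClass_surjective c
  simp only [cuspClass_eq_iff_exists_mem_signedGamma]
  rw [ncard_setOf_exists_mul_out_mem, card_map_mk'_stabilizerInfty]

lemma IsModularFunction.cuspClass_mem_cuspPoles_iff [NeZero m] (hmod : IsModularFunction m h)
    (hinfty : ¬ HasPoleAtCusp m h OnePoint.infty) (γ : SL(2, ℤ)) :
    cuspClass m γ ∈ cuspPoles m h ↔ meromorphicOrderAt (cuspExpansion m h γ) 0 < 0 := by
  have hpole := hmod.hasPoleAtCusp_smul_infty_iff (NeZero.ne m)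
  rw [hmod.meromorphicOrderAt_cuspExpansion_neg_iff (NeZero.ne m)]
  constructor
  · rintro ⟨⟨c, hc⟩, hγc, hc', -⟩
    obtain ⟨γ', rfl⟩ := isCusp_SL2Z_iff'.mp ((Subgroup.IsArithmetic.isCusp_iff_isCusp_SL2Z _).mp hc)
    obtain ⟨N, hN, heq⟩ := cuspClass_eq_iff.mp hγc
    change HasPoleAtCusp m h (Matrix.SpecialLinearGroup.mapGL ℝ γ' • OnePoint.infty) at hc'
    rw [← heq, hpole] at hc'
    simpa only [SemigroupAction.mul_smul, hmod.invariant N hN] using hc'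
  · refine fun hγ ↦ ⟨_, rfl, (hpole γ).mpr hγ, ?_⟩
    rintro _ ⟨N, hN, rfl⟩ heq
    have hN' := (hpole N).mp (by rw [heq]; exact (hpole γ).mpr hγ)
    have hone := (hpole 1).mpr (by simpa only [hmod.invariant N hN, one_smul] using hN')
    rw [map_one, one_smul] at hone
    exact hinfty hone

end Poles

/-! ### Solutions of the Schwarz equation -/

lemma frequently_atImInfty {P : ℍ → Prop} (hP : ∀ τ, ∀ᶠ σ in 𝓝[≠] τ, P σ) :
    ∃ᶠ τ in atImInfty, P τ := by
  intro hnot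
  obtain ⟨A, hA⟩ := (atImInfty_mem _).mp hnot
  have hgt : ∀ᶠ τ in atImInfty, A < UpperHalfPlane.im τ := tendsto_comap.eventually_gt_atTop A
  obtain ⟨τ, him⟩ := hgt.exists
  have hnhds : ∀ᶠ σ in 𝓝[≠] τ, A < UpperHalfPlane.im σ :=
    (continuous_im.continuousAt.eventually (lt_mem_nhds him)).filter_mono nhdsWithin_le_nhds
  obtain ⟨σ, hσ, hPσ⟩ := (hnhds.and (hP τ)).exists
  exact hA σ hσ.le hPσ

lemma frequently_E₄_ne_zero (τ : ℍ) :
    ∃ᶠ z in 𝓝[≠] (τ : ℂ), ModularForm.E₄ (ofComplex z) ≠ 0 := by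
  intro hzero
  have hzero' : ∀ᶠ σ in 𝓝[≠] τ, ModularForm.E₄ σ = 0 := by
    simpa using (tendsto_coe_nhdsNE τ).eventually hzero
  have hlim := tendsto_E₄_atImInfty
  rw [UpperHalfPlane.eq_zero_of_frequently (ModularFormClass.holo ModularForm.E₄)
    hzero'.frequently] at hlim
  exact one_ne_zero (tendsto_nhds_unique hlim tendsto_const_nhds)

section SchwarzSolution

variable {m n : ℕ} {h : ℍ → ℂ}

lemma IsSchwarzSolution.eventually_schwarzDeriv_eq (hsol : IsSchwarzSolution m n h) (τ : ℍ) :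
    ∀ᶠ z in 𝓝[≠] (τ : ℂ), schwarzDeriv (h ∘ ofComplex) z =
      2 * (Real.pi : ℂ) ^ 2 * ((n : ℂ) / (m : ℂ)) ^ 2 * ModularForm.E₄ (ofComplex z) := by
  filter_upwards [mem_codiscreteWithin_iff_forall_mem_nhdsNE.mp hsol τ τ.im_pos,
    nhdsWithin_le_nhds (isOpen_upperHalfPlaneSet.mem_nhds τ.im_pos)] with z hz him
  exact hz.resolve_right fun hnot ↦ hnot him

lemma IsModularFunction.meromorphicOrderAt_deriv (hmod : IsModularFunction m h)
    (hsol : IsSchwarzSolution m n h) (hm : m ≠ 0) (hn : n ≠ 0) (τ : ℍ)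
    [Decidable (HasPoleAt h τ)] :
    meromorphicOrderAt (deriv (h ∘ ofComplex)) τ = (if HasPoleAt h τ then -2 else 0 : ℤ) := by
  have hc : 2 * (Real.pi : ℂ) ^ 2 * ((n : ℂ) / (m : ℂ)) ^ 2 ≠ 0 := by
    simp [hm, hn, Real.pi_ne_zero]
  let _ : Decidable (meromorphicOrderAt (h ∘ ofComplex) (τ : ℂ) < 0) :=
    inferInstanceAs (Decidable (HasPoleAt h τ))
  exact meromorphicOrderAt_deriv_of_schwarzDeriv_eq (hmod.meromorphicAt τ)
    ((analyticAt_E₄ τ).continuousAt.const_mul _)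
    ((frequently_E₄_ne_zero τ).mono fun z ↦ mul_ne_zero hc) (hsol.eventually_schwarzDeriv_eq τ)

lemma IsModularFunction.frequently_schwarzDeriv_smul_eq (hmod : IsModularFunction m h)
    (hsol : IsSchwarzSolution m n h) (hm : m ≠ 0) (hn : n ≠ 0) (γ : SL(2, ℤ)) :
    ∃ᶠ τ : ℍ in atImInfty, deriv ((fun σ ↦ h (γ • σ)) ∘ ofComplex) τ ≠ 0 ∧
      schwarzDeriv ((fun σ ↦ h (γ • σ)) ∘ ofComplex) τ =
        2 * (Real.pi : ℂ) ^ 2 * ((n : ℂ) / (m : ℂ)) ^ 2 * ModularForm.E₄ τ := by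
  classical
  refine frequently_atImInfty fun τ ↦ ?_
  have hlim := (tendsto_coe_nhdsNE (γ • τ)).comp (tendsto_SL_smul_nhdsNE γ τ)
  have hne : ∀ᶠ z in 𝓝[≠] ((γ • τ : ℍ) : ℂ), deriv (h ∘ ofComplex) z ≠ 0 :=
    (meromorphicOrderAt_ne_top_iff_eventually_ne_zero (hmod.meromorphicAt _).deriv).mp
      (by rw [hmod.meromorphicOrderAt_deriv hsol hm hn]; exact WithTop.coe_ne_top)
  filter_upwards [hlim.eventually (hmod.meromorphicAt (γ • τ)).eventually_analyticAt,
    hlim.eventually hne, hlim.eventually (hsol.eventually_schwarzDeriv_eq (γ • τ))]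
    with σ hana hne hS
  have hdenom := denom_ne_zero γ σ
  simp only [Function.comp_apply, ofComplex_apply] at hana hne hS
  refine ⟨?_, ?_⟩
  · rw [deriv_comp_SL_smul]
    exact mul_ne_zero hne (zpow_ne_zero _ hdenom)
  · rw [schwarzDeriv_comp_SL_smul hana hne, hS, E₄_smul]
    field_simp

lemma IsModularFunction.isTheta_deriv_smul (hmod : IsModularFunction m h)
    (hsol : IsSchwarzSolution m n h) (hm : m ≠ 0) (hn : n ≠ 0) (γ : SL(2, ℤ))
    [Decidable (meromorphicOrderAt (cuspExpansion m h γ) 0 < 0)] :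
    (fun τ : ℍ ↦ deriv ((fun σ ↦ h (γ • σ)) ∘ ofComplex) τ) =Θ[atImInfty]
      fun τ : ℍ ↦ Function.Periodic.qParam m τ ^
        (if meromorphicOrderAt (cuspExpansion m h γ) 0 < 0 then -n else n : ℤ) := by
  have hF := hmod.meromorphic_cusps γ
  have hf := hmod.apply_SL_smul hm γ
  have hS := hmod.frequently_schwarzDeriv_smul_eq hsol hm hn γ
  obtain ⟨l, hl⟩ := WithTop.ne_top_iff_exists.mp
    (meromorphicOrderAt_deriv_ne_top_of_frequently hm hF hf (hS.mono fun τ hτ ↦ hτ.1))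
  have hlim := tendsto_schwarzDeriv_atImInfty hm hF hf hl.symm
  have hlim' := tendsto_E₄_atImInfty.const_mul
    (2 * (Real.pi : ℂ) ^ 2 * ((n : ℂ) / (m : ℂ)) ^ 2)
  have heq := tendsto_nhds_unique_of_frequently_eq hlim hlim' (hS.mono fun τ hτ ↦ hτ.2)
  have hindicial : (l + 1) ^ 2 = (n : ℤ) ^ 2 := by
    field_simp at heq
    exact_mod_cast heq
  convert isTheta_deriv_comp_ofComplex hm hF hf hl.symm using 3
  split_ifs with hneg <;> rw [meromorphicOrderAt_neg_iff hF hl.symm] at hneg <;>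
    rcases sq_eq_sq_iff_eq_or_eq_neg.mp hindicial with h | h <;> omega

end SchwarzSolution

/-! ### The valence formula -/

/-- The function `h' ^ 6 / Δ`, in which the weight `12` of `h' ^ 6` is compensated by that of `Δ`:
it is a modular function if `h` is. -/
noncomputable def derivPowDivDiscriminant (h : ℍ → ℂ) (τ : ℍ) : ℂ :=
  deriv (h ∘ ofComplex) τ ^ 6 / ModularForm.discriminant τ

lemma derivPowDivDiscriminant_smul (h : ℍ → ℂ) (γ : SL(2, ℤ)) (τ : ℍ) :
    derivPowDivDiscriminant h (γ • τ) = derivPowDivDiscriminant (fun σ ↦ h (γ • σ)) τ := by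
  have hdenom := denom_ne_zero γ τ
  have hΔ := ModularForm.discriminant_ne_zero τ
  rw [derivPowDivDiscriminant, derivPowDivDiscriminant, deriv_comp_SL_smul, discriminant_smul]
  field_simp

lemma derivPowDivDiscriminant_comp_ofComplex (h : ℍ → ℂ) (τ : ℍ) :
    derivPowDivDiscriminant h ∘ ofComplex =ᶠ[𝓝 (τ : ℂ)]
      deriv (h ∘ ofComplex) ^ 6 * (ModularForm.discriminant ∘ ofComplex)⁻¹ :=
  eventually_mem_upperHalfPlane (fun σ ↦ by simp [derivPowDivDiscriminant, div_eq_mul_inv]) τ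

section Valence

variable {m n : ℕ} {h : ℍ → ℂ}

lemma IsModularFunction.meromorphicAt_derivPowDivDiscriminant (hmod : IsModularFunction m h)
    (τ : ℍ) : MeromorphicAt (derivPowDivDiscriminant h ∘ ofComplex) τ :=
  (((hmod.meromorphicAt τ).deriv.pow 6).mul (analyticAt_discriminant τ).meromorphicAt.inv).congr
    ((derivPowDivDiscriminant_comp_ofComplex h τ).symm.filter_mono nhdsWithin_le_nhds)

lemma IsModularFunction.meromorphicOrderAt_derivPowDivDiscriminant (hmod : IsModularFunction m h)
    (hsol : IsSchwarzSolution m n h) (hm : m ≠ 0) (hn : n ≠ 0) (τ : ℍ)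
    [Decidable (HasPoleAt h τ)] :
    meromorphicOrderAt (derivPowDivDiscriminant h ∘ ofComplex) τ =
      (if HasPoleAt h τ then -12 else 0 : ℤ) := by
  have hΔ := analyticAt_discriminant τ
  have hΔ0 : meromorphicOrderAt (ModularForm.discriminant ∘ ofComplex) τ = 0 := by
    rw [hΔ.meromorphicOrderAt_eq, hΔ.analyticOrderAt_eq_zero.mpr
      (ModularForm.discriminant_ne_zero _)]
    rfl
  have hF := (hmod.meromorphicAt τ).deriv
  rw [meromorphicOrderAt_congr
      ((derivPowDivDiscriminant_comp_ofComplex h τ).filter_mono nhdsWithin_le_nhds),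
    meromorphicOrderAt_mul (hF.pow 6) hΔ.meromorphicAt.inv, meromorphicOrderAt_pow hF,
    meromorphicOrderAt_inv, hΔ0, hmod.meromorphicOrderAt_deriv hsol hm hn]
  split_ifs <;> rfl

lemma IsModularFunction.isTheta_derivPowDivDiscriminant_smul (hmod : IsModularFunction m h)
    (hsol : IsSchwarzSolution m n h) (hm : m ≠ 0) (hn : n ≠ 0) (γ : SL(2, ℤ))
    [Decidable (meromorphicOrderAt (cuspExpansion m h γ) 0 < 0)] :
    (fun τ ↦ derivPowDivDiscriminant h (γ • τ)) =Θ[atImInfty]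
      fun τ : ℍ ↦ Function.Periodic.qParam m τ ^
        (6 * (if meromorphicOrderAt (cuspExpansion m h γ) 0 < 0 then -n else n : ℤ) - m) := by
  simp_rw [derivPowDivDiscriminant_smul, derivPowDivDiscriminant]
  refine (((hmod.isTheta_deriv_smul hsol hm hn γ).pow 6).div
    (isTheta_discriminant hm)).trans_eventuallyEq (.of_forall fun τ ↦ ?_)
  have hq := Function.Periodic.qParam_ne_zero (h := m) (τ : ℂ)
  beta_reduce
  rw [zpow_sub₀ hq, mul_comm, zpow_mul, zpow_ofNat]

open Classical in
lemma IsModularFunction.sum_cusp_exponents [NeZero m] [Fintype (SL(2, ℤ) ⧸ signedGamma m)]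
    (hmod : IsModularFunction m h) (hinfty : ¬ HasPoleAtCusp m h OnePoint.infty) (n : ℕ) :
    ∑ x : SL(2, ℤ) ⧸ signedGamma m,
      (6 * (if meromorphicOrderAt (cuspExpansion m h x.out) 0 < 0 then -n else n : ℤ) - m) =
      (signedGamma m).index * (6 * n - m) - 12 * m * n * (cuspPoles m h).ncard := by
  set g : CuspOrbits (Gamma m : Subgroup (GL (Fin 2) ℝ)) → ℤ :=
    fun c ↦ if c ∈ cuspPoles m h then -(12 * n) else 0
  set S : Finset (CuspOrbits (Gamma m : Subgroup (GL (Fin 2) ℝ))) :=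
    (Set.toFinite (cuspPoles m h)).toFinset
  have hS : ∀ c ∈ S, ({x : SL(2, ℤ) ⧸ signedGamma m | cuspClass m x.out = c}.ncard : ℤ) * g c =
      m * -(12 * n) := fun c hc ↦ by
    rw [ncard_setOf_cuspClass_eq,
      show g c = -(12 * n) from if_pos ((Set.Finite.mem_toFinset _).mp hc)]
  calc _ = ∑ x : SL(2, ℤ) ⧸ signedGamma m, ((6 * n - m) + g (cuspClass m x.out)) :=
        Finset.sum_congr rfl fun x _ ↦ by
          simp only [g, hmod.cuspClass_mem_cuspPoles_iff hinfty]
          split_ifs <;> ring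
    _ = (signedGamma m).index * (6 * n - m) + ∑ c ∈ S, (m * -(12 * n) : ℤ) := by
        rw [Finset.sum_add_distrib,
          sum_comp_eq_sum_ncard_mul _ S fun c hc ↦ if_neg (by simpa [S] using hc),
          Finset.sum_congr rfl hS, Finset.sum_const, Finset.card_univ, nsmul_eq_mul,
          Subgroup.index, Nat.card_eq_fintype_card]
    _ = _ := by
        rw [Finset.sum_const, ← Set.ncard_eq_toFinset_card, nsmul_eq_mul]
        ring

theorem IsModularFunction.valence_formula (hmod : IsModularFunction m h)
    (hsol : IsSchwarzSolution m n h) (hm : 2 ≤ m) (hn : n ≠ 0)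
    (hinfty : ¬ HasPoleAtCusp m h OnePoint.infty) :
    12 * m * ((interiorPoles m h).ncard + n * (cuspPoles m h).ncard : ℤ) =
      (signedGamma m).index * (6 * n - m) := by
  classical
  have hm' : m ≠ 0 := by omega
  have : NeZero m := ⟨hm'⟩
  have : Fintype (SL(2, ℤ) ⧸ signedGamma m) := Fintype.ofFinite _
  have hfin := hmod.finite_interiorPoles hm'
  set S := hfin.toFinset
  set ord : MulAction.orbitRel.Quotient (Gamma m) ℍ → ℤ :=
    fun q ↦ if q ∈ interiorPoles m h then -12 else 0
  have hinv : ∀ γ ∈ Gamma m, ∀ τ,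
      derivPowDivDiscriminant h (γ • τ) = derivPowDivDiscriminant h τ := fun γ hγ τ ↦ by
    simp only [derivPowDivDiscriminant_smul, hmod.invariant γ hγ]
  have hord (τ : ℍ) : meromorphicOrderAt (derivPowDivDiscriminant h ∘ ofComplex) τ =
      ord (orbitClass m τ) := by
    simp only [hmod.meromorphicOrderAt_derivPowDivDiscriminant hsol hm' hn, ord,
      hmod.orbitClass_mem_interiorPoles_iff]
  have hS : ∑ q ∈ S, ord q = -12 * (interiorPoles m h).ncard := by
    rw [Finset.sum_congr rfl fun q hq ↦ if_pos ((Set.Finite.mem_toFinset _).mp hq),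
      Finset.sum_const, ← Set.ncard_eq_toFinset_card _ hfin, nsmul_eq_mul, mul_comm]
  have hdeg := sum_exponent_add_sum_order hm hinv hmod.meromorphicAt_derivPowDivDiscriminant hord
    (S := S) (fun q hq ↦ if_neg (by simpa [S] using hq))
    fun x ↦ hmod.isTheta_derivPowDivDiscriminant_smul hsol hm' hn x.out
  rw [hmod.sum_cusp_exponents hinfty, hS] at hdeg
  linear_combination -hdeg

/-- There are `(signedGamma m).index / m` cusps, so fewer than half of them are poles of `h`. -/
lemma IsModularFunction.two_mul_mul_ncard_cuspPoles_lt (hmod : IsModularFunction m h)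
    (hsol : IsSchwarzSolution m n h) (hm : 2 ≤ m) (hn : n ≠ 0)
    (hinfty : ¬ HasPoleAtCusp m h OnePoint.infty) :
    2 * m * (cuspPoles m h).ncard < (signedGamma m).index := by
  have : NeZero m := ⟨by omega⟩
  have hval := hmod.valence_formula hsol hm hn hinfty
  have hn' : (0 : ℤ) < 6 * n := by omega
  have hindex : (0 : ℤ) < (signedGamma m).index := by
    exact_mod_cast (Subgroup.index_ne_zero_of_finite (H := signedGamma m)).bot_lt
  have hm' : (0 : ℤ) < m := by omega
  suffices (6 * n * (2 * m * (cuspPoles m h).ncard) : ℤ) < 6 * n * (signedGamma m).index by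
    exact_mod_cast lt_of_mul_lt_mul_left this hn'.le
  nlinarith [mul_nonneg hm'.le (Int.natCast_nonneg (interiorPoles m h).ncard),
    mul_pos hindex hm']

end Valence

end ModularSchwarz

theorem proposition4p1 (m n : ℕ) (hm2 : 2 ≤ m) (hm5 : m ≤ 5) (hn : 0 < n) (h : UpperHalfPlane → ℂ)
    (hmod : ModularSchwarz.IsModularFunction m h)
    (hsol : ModularSchwarz.IsSchwarzSolution m n h)
    (hinfty : ¬ ModularSchwarz.HasPoleAtCusp m h OnePoint.infty)
    (a b : ℕ)
    (ha : a = (ModularSchwarz.interiorPoles m h).ncard)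
    (hb : b = (ModularSchwarz.cuspPoles m h).ncard) :
    (ModularSchwarz.interiorPoles m h).Finite ∧ (ModularSchwarz.cuspPoles m h).Finite ∧
    (m = 2 → ((a : ℚ), (b : ℚ)) ∈
      ({((3 * (n : ℚ) - 1) / 2, 0), (((n : ℚ) - 1) / 2, 1)} : Set (ℚ × ℚ))) ∧
    (m = 3 → ((a : ℤ), (b : ℤ)) ∈
      ({(2 * (n : ℤ) - 1, 0), ((n : ℤ) - 1, 1)} : Set (ℤ × ℤ))) ∧
    (m = 4 → ((a : ℤ), (b : ℤ)) ∈
      ({(3 * (n : ℤ) - 2, 0), (2 * (n : ℤ) - 2, 1), ((n : ℤ) - 2, 2)} : Set (ℤ × ℤ))) ∧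
    (m = 5 → ∃ k : ℤ, 0 ≤ k ∧ k ≤ 5 ∧
      ((a : ℤ), (b : ℤ)) = ((n : ℤ) * (6 - k) - 5, k)) := by
  have hm : m ≠ 0 := by omega
  have : NeZero m := ⟨hm⟩
  have hval := hmod.valence_formula hsol hm2 hn.ne' hinfty
  have hlt := hmod.two_mul_mul_ncard_cuspPoles_lt hsol hm2 hn.ne' hinfty
  rw [← ha, ← hb] at hval
  rw [← hb] at hlt
  clear ha hb
  refine ⟨hmod.finite_interiorPoles hm, Set.toFinite _, ?_, ?_, ?_, ?_⟩ <;> rintro rfl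
  · rw [ModularSchwarz.index_signedGamma_two] at hval hlt
    have hval' : (12 * 2 * (a + n * b) : ℚ) = 6 * (6 * n - 2) := by exact_mod_cast hval
    simp only [Set.mem_insert_iff, Set.mem_singleton_iff, Prod.mk.injEq]
    obtain rfl | rfl : b = 0 ∨ b = 1 := by omega
    · exact .inl ⟨by push_cast at hval'; linarith, Nat.cast_zero⟩
    · exact .inr ⟨by push_cast at hval'; linarith, Nat.cast_one⟩
  · rw [ModularSchwarz.index_signedGamma_three] at hval hlt
    simp only [Set.mem_insert_iff, Set.mem_singleton_iff, Prod.mk.injEq]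
    obtain rfl | rfl : b = 0 ∨ b = 1 := by omega
    all_goals omega
  · rw [ModularSchwarz.index_signedGamma_four] at hval hlt
    simp only [Set.mem_insert_iff, Set.mem_singleton_iff, Prod.mk.injEq]
    obtain rfl | rfl | rfl : b = 0 ∨ b = 1 ∨ b = 2 := by omega
    all_goals omega
  · rw [ModularSchwarz.index_signedGamma_five] at hval hlt
    refine ⟨b, by omega, by omega, Prod.ext ?_ rfl⟩
    push_cast at hval ⊢
    linarith
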